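/- Consider the Gaussian interference relay-without-delay channel with real gains $h_{ij},h_{Rj}$ ($i,j\in\{1,2\}$) and $\mathbf h_{1R},\mathbf h_{2R}\in\mathbb R^2$. In each channel use the sources send $X_1,X_2\in\mathbb R$, the relay receives $Y_R=h_{R1}X_1+h_{R2}X_2+Z_R$ and sends $\mathbf X_R\in\mathbb R^2$, and destination $i$ receives $$Y_i=h_{i1}X_1+h_{i2}X_2+\mathbf h_{iR}\cdot\mathbf X_R+Z_i,\qquad i=1,2,$$ where $Z_R,Z_1,Z_2\sim N(0,1)$ are independent of each other and across channel uses, and of the messages. A $(2^{nR_1},2^{nR_2},n)$ code ($R_1,R_2\ge 0$) consists of message sets $\{1,\dots,\lceil 2^{nR_j}\rceil\}$, codewords $x_j^n(m_j)\in\mathbb R^n$ ($j=1,2$), measurable relay functions $\mathbf x_{R,i}=f_i(y_{R,1},\dots,y_{R,i})$, $1\le i\le n$ (the relay may use its current received symbol), and measurable decoders that map $y_j^n$ to a message $\hat m_j$ or to an error. The messages are independent and uniform. The average power constraints are $E\big[\sum_{i}X_{j,i}^2\big]\le nP$ for $j=1,2$ and $E\big[\sum_{i}\|\mathbf X_{R,i}\|^2\big]\le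 nP_R$, the expectations being over the messages and the noise, where $P,P_R\ge 0$. (These constraints hold in particular when every codeword has average power at most $P$.) A pair $(R_1,R_2)$ is achievable if there is a sequence of such codes with $\Pr\big((\hat M_1,\hat M_2)\ne(M_1,M_2)\big)\to 0$ as $n\to\infty$, and the capacity region is the closure of the set of achievable pairs. The channel is called strong if $$I(X_1;Y_1|X_2,Y_R,\mathbf X_R)\le I(X_1;Y_2|X_2,Y_R,\mathbf X_R),\qquad I(X_2;Y_2|X_1,Y_R,\mathbf X_R)\le I(X_2;Y_1|X_1,Y_R,\mathbf X_R)$$ for all independent input distributions $p(x_1)p(x_2)$ and all conditional distributions $p(\mathbf x_R|y_R)$. **Theorem.** For a strong Gaussian interference relay-without-delay channel, the capacity region is contained in the set of pairs $(R_1,R_2)$ such that \begin{align*} R_1 &\le \tfrac12\log_2\big(1+(h_{11}^2+h_{R1}^2)P\big),\\ R_2 &\le \tfrac12\log_2\big(1+(h_{22}^2+h_{R2}^2)P\big),\\ R_1+R_2 &\le \tfrac12\log_2\Big(1+(h_{11}^2+h_{12}^2+h_{R1}^2+h_{R2}^2)P+\big((h_{11}^2+h_{12}^2)(h_{R1}^2+h_{R2}^2)-(h_{11}h_{R1}+h_{12}h_{R2})^2\big)P^2\Big),\\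 R_1+R_2 &\le \tfrac12\log_2\Big(1+(h_{21}^2+h_{22}^2+h_{R1}^2+h_{R2}^2)P+\big((h_{21}^2+h_{22}^2)(h_{R1}^2+h_{R2}^2)-(h_{21}h_{R1}+h_{22}h_{R2})^2\big)P^2\Big). \end{align*} -/

import Mathlib

open MeasureTheory ProbabilityTheory InformationTheory Filter
open scoped ENNReal Topology Matrix

noncomputable section

/-- Conditional mutual information `I(X; Y | Z)` of random variables on `(Ω, μ)`: the
Kullback–Leibler divergence of the joint law of `(Z, X, Y)` from the law under which `X` and `Y`
are conditionally independent given `Z`, with the same conditional marginals. It takes values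
in `[0, ∞]` and is defined for arbitrary (discrete, continuous or mixed) laws. -/
def condMutualInfo {Ω α β γ : Type*} [MeasurableSpace Ω]
    [MeasurableSpace α] [StandardBorelSpace α] [Nonempty α]
    [MeasurableSpace β] [StandardBorelSpace β] [Nonempty β] [MeasurableSpace γ]
    (μ : Measure Ω) [IsFiniteMeasure μ] (X : Ω → α) (Y : Ω → β) (Z : Ω → γ) : ℝ≥0∞ :=
  klDiv (μ.map (fun ω => (Z ω, X ω, Y ω)))
    ((μ.map Z) ⊗ₘ (condDistrib X Z μ ×ₖ condDistrib Y Z μ))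

/-- The channel gains of a Gaussian interference relay-without-delay channel. `hij` is the gain
from source `j` to destination `i`, `hRj` the gain from source `j` to the relay, and `hiR k` the
gain from the `k`-th transmit antenna of the relay to destination `i`. -/
structure GaussianIRC where
  h11 : ℝ
  h12 : ℝ
  h21 : ℝ
  h22 : ℝ
  hR1 : ℝ
  hR2 : ℝ
  h1R : Fin 2 → ℝ
  h2R : Fin 2 → ℝ

namespace GaussianIRC

variable (ch : GaussianIRC)

/-- Signal received by the relay: `Y_R = h_{R1} X₁ + h_{R2} X₂ + Z_R`. -/
def outR (x₁ x₂ zR : ℝ) : ℝ := ch.hR1 * x₁ + ch.hR2 * x₂ + zR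

/-- Signal received by destination 1: `Y₁ = h₁₁ X₁ + h₁₂ X₂ + h_{1R} · X_R + Z₁`. -/
def out1 (x₁ x₂ : ℝ) (xR : Fin 2 → ℝ) (z₁ : ℝ) : ℝ :=
  ch.h11 * x₁ + ch.h12 * x₂ + ch.h1R ⬝ᵥ xR + z₁

/-- Signal received by destination 2: `Y₂ = h₂₁ X₁ + h₂₂ X₂ + h_{2R} · X_R + Z₂`. -/
def out2 (x₁ x₂ : ℝ) (xR : Fin 2 → ℝ) (z₂ : ℝ) : ℝ :=
  ch.h21 * x₁ + ch.h22 * x₂ + ch.h2R ⬝ᵥ xR + z₂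

/-! ### The strong interference condition -/

/-- Sample space of one channel use: `(((x₁, x₂, z_R), x_R), (z₁, z₂))`. -/
abbrev Single : Type := ((ℝ × ℝ × ℝ) × (Fin 2 → ℝ)) × (ℝ × ℝ)

namespace Single

def x₁ (ω : Single) : ℝ := ω.1.1.1
def x₂ (ω : Single) : ℝ := ω.1.1.2.1
def zR (ω : Single) : ℝ := ω.1.1.2.2
def xR (ω : Single) : Fin 2 → ℝ := ω.1.2
def z₁ (ω : Single) : ℝ := ω.2.1
def z₂ (ω : Single) : ℝ := ω.2.2

end Single

/-- Joint law of one channel use under `p(x₁) p(x₂) p(y_R | x₁, x₂) p(x_R | y_R)` and the channel: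
`X₁ ∼ p₁`, `X₂ ∼ p₂` and `Z_R ∼ N(0,1)` are independent, `X_R` is drawn from `κ` given `Y_R`, and
`Z₁, Z₂ ∼ N(0,1)` are independent of each other and of all the rest. -/
def singleLaw (p₁ p₂ : Measure ℝ) (κ : Kernel ℝ (Fin 2 → ℝ)) : Measure Single :=
  ((p₁.prod (p₂.prod (gaussianReal 0 1))) ⊗ₘ
      (κ.comap (fun t : ℝ × ℝ × ℝ => ch.outR t.1 t.2.1 t.2.2)
        (by unfold outR; fun_prop))).prod
    ((gaussianReal 0 1).prod (gaussianReal 0 1))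

instance (p₁ p₂ : Measure ℝ) [IsProbabilityMeasure p₁] [IsProbabilityMeasure p₂]
    (κ : Kernel ℝ (Fin 2 → ℝ)) [IsMarkovKernel κ] :
    IsProbabilityMeasure (ch.singleLaw p₁ p₂ κ) := by
  unfold singleLaw; infer_instance

/-- The relay's received symbol in one channel use. -/
def singleYR (ω : Single) : ℝ := ch.outR ω.x₁ ω.x₂ ω.zR

/-- The symbol received by destination 1 in one channel use. -/
def singleY1 (ω : Single) : ℝ := ch.out1 ω.x₁ ω.x₂ ω.xR ω.z₁

/-- The symbol received by destination 2 in one channel use. -/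
def singleY2 (ω : Single) : ℝ := ch.out2 ω.x₁ ω.x₂ ω.xR ω.z₂

/-- The strong interference condition: `I(X₁; Y₁ | X₂, Y_R, X_R) ≤ I(X₁; Y₂ | X₂, Y_R, X_R)` and
`I(X₂; Y₂ | X₁, Y_R, X_R) ≤ I(X₂; Y₁ | X₁, Y_R, X_R)` for all independent inputs and all
`p(x_R | y_R)`. -/
def IsStrong : Prop :=
  ∀ (p₁ p₂ : Measure ℝ) [IsProbabilityMeasure p₁] [IsProbabilityMeasure p₂]
    (κ : Kernel ℝ (Fin 2 → ℝ)) [IsMarkovKernel κ],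
    condMutualInfo (ch.singleLaw p₁ p₂ κ) Single.x₁ ch.singleY1
        (fun ω => (ω.x₂, ch.singleYR ω, ω.xR)) ≤
      condMutualInfo (ch.singleLaw p₁ p₂ κ) Single.x₁ ch.singleY2
        (fun ω => (ω.x₂, ch.singleYR ω, ω.xR)) ∧
    condMutualInfo (ch.singleLaw p₁ p₂ κ) Single.x₂ ch.singleY2
        (fun ω => (ω.x₁, ch.singleYR ω, ω.xR)) ≤
      condMutualInfo (ch.singleLaw p₁ p₂ κ) Single.x₂ ch.singleY1
        (fun ω => (ω.x₁, ch.singleYR ω, ω.xR))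

/-! ### Codes and the capacity region -/

/-- A code of block length `n` with `M₁` and `M₂` messages: deterministic encoders, relay functions
`x_{R,i} = f_i(y_{R,1}, …, y_{R,i})` that may use the current received symbol, and decoders that
output a message or an error (`none`). -/
structure Code (M₁ M₂ n : ℕ) where
  enc₁ : Fin M₁ → Fin n → ℝ
  enc₂ : Fin M₂ → Fin n → ℝ
  relay : (i : Fin n) → (Fin (i + 1) → ℝ) → Fin 2 → ℝ
  dec₁ : (Fin n → ℝ) → Option (Fin M₁)
  dec₂ : (Fin n → ℝ) → Option (Fin M₂)
  measurable_relay : ∀ i, Measurable (relay i)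
  measurable_dec₁ : ∀ a, MeasurableSet (dec₁ ⁻¹' {a})
  measurable_dec₂ : ∀ a, MeasurableSet (dec₂ ⁻¹' {a})

/-- The noise sequences `(z_R, z₁, z₂)` over a block of length `n`. -/
abbrev Noise (n : ℕ) : Type := (Fin n → ℝ) × (Fin n → ℝ) × (Fin n → ℝ)

/-- All `3 n` noise variables are independent with law `N(0,1)`. -/
def noiseLaw (n : ℕ) : Measure (Noise n) :=
  (Measure.pi fun _ => gaussianReal 0 1).prod
    ((Measure.pi fun _ => gaussianReal 0 1).prod (Measure.pi fun _ => gaussianReal 0 1))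

namespace Code

variable {M₁ M₂ n : ℕ} (c : Code M₁ M₂ n)

/-- The sequence received by the relay. -/
def seqYR (m₁ : Fin M₁) (m₂ : Fin M₂) (z : Noise n) (i : Fin n) : ℝ :=
  ch.outR (c.enc₁ m₁ i) (c.enc₂ m₂ i) (z.1 i)

/-- The sequence transmitted by the relay: the `i`-th symbol is a function of the received symbols
with indices `≤ i`. -/
def seqXR (m₁ : Fin M₁) (m₂ : Fin M₂) (z : Noise n) (i : Fin n) : Fin 2 → ℝ :=
  c.relay i (fun j => c.seqYR ch m₁ m₂ z (Fin.castLE i.isLt j))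

/-- The sequence received by destination 1. -/
def seqY1 (m₁ : Fin M₁) (m₂ : Fin M₂) (z : Noise n) (i : Fin n) : ℝ :=
  ch.out1 (c.enc₁ m₁ i) (c.enc₂ m₂ i) (c.seqXR ch m₁ m₂ z i) (z.2.1 i)

/-- The sequence received by destination 2. -/
def seqY2 (m₁ : Fin M₁) (m₂ : Fin M₂) (z : Noise n) (i : Fin n) : ℝ :=
  ch.out2 (c.enc₁ m₁ i) (c.enc₂ m₂ i) (c.seqXR ch m₁ m₂ z i) (z.2.2 i)

/-- Average power constraints `P` at the sources and `P_R` at the relay: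
`E[∑ᵢ X_{j,i}²] ≤ n P` for `j = 1, 2` and `E[∑ᵢ ‖X_{R,i}‖²] ≤ n P_R`, the expectation being over
uniform messages and the noise. Codes all of whose codewords (and, for the relay, all of whose
transmitted sequences) have average power at most `P` (resp. `P_R`) satisfy this. -/
def PowerConstraint (P P_R : ℝ) : Prop :=
  (M₁ : ℝ)⁻¹ * ∑ m₁, ∑ i, c.enc₁ m₁ i ^ 2 ≤ n * P ∧
  (M₂ : ℝ)⁻¹ * ∑ m₂, ∑ i, c.enc₂ m₂ i ^ 2 ≤ n * P ∧
  (M₁ * M₂ : ℝ≥0∞)⁻¹ * ∑ m₁, ∑ m₂,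
      ∫⁻ z, ENNReal.ofReal (∑ i, ∑ k, c.seqXR ch m₁ m₂ z i k ^ 2) ∂(noiseLaw n) ≤
    ENNReal.ofReal (n * P_R)

/-- Average probability of error `P((M̂₁, M̂₂) ≠ (M₁, M₂))` for independent uniform messages. -/
def errorProb : ℝ :=
  (M₁ * M₂ : ℝ)⁻¹ * ∑ m₁, ∑ m₂,
    (noiseLaw n).real {z | ¬ (c.dec₁ (c.seqY1 ch m₁ m₂ z) = some m₁ ∧
      c.dec₂ (c.seqY2 ch m₁ m₂ z) = some m₂)}

end Code

/-- The number `⌈2 ^ (n R)⌉` of messages of a code of rate `R` and block length `n`. -/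
def numMessages (n : ℕ) (R : ℝ) : ℕ := ⌈(2 : ℝ) ^ (n * R)⌉₊

/-- `(R₁, R₂)` is achievable if there is a sequence of `(2^{n R₁}, 2^{n R₂}, n)` codes that satisfy
the power constraints and whose average probability of error tends to `0`. -/
def Achievable (P P_R : ℝ) (R : ℝ × ℝ) : Prop :=
  0 ≤ R.1 ∧ 0 ≤ R.2 ∧
    ∃ c : (n : ℕ) → Code (numMessages n R.1) (numMessages n R.2) n,
      (∀ n, (c n).PowerConstraint ch P P_R) ∧
      Tendsto (fun n => (c n).errorProb ch) atTop (𝓝 0)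

/-- The capacity region: the closure of the set of achievable rate pairs. -/
def capacityRegion (P P_R : ℝ) : Set (ℝ × ℝ) := closure {R | ch.Achievable P P_R R}

end GaussianIRC

end

/-! The relay disappears once destination 1 is also given the relay's received sequence: the relay's
transmissions are functions of that sequence, so they can be added or removed at will. What remains
is a memoryless Gaussian channel with two real outputs, `Y_R` and `h₁₁ X₁ + h₁₂ X₂ + Z₁`, and the
right-hand sides are its Gaussian capacity expressions `½ log det (I + P H Hᵀ)`. The individual rate
bound for source 1 fixes the other message and treats its codeword as a known offset.

For the sum rate, destination 1 must recover both messages. Testing the strong condition on one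
standard Gaussian input, with the other source and the relay silent, yields `h₁₁² ≤ h₂₁²` and `h₂₂²
≤ h₁₂²` (`IsStrong.sq_gain_le`). Hence, after decoding `m₁`, destination 1 can subtract `X₁`, scale
by `sin θ` with `h₁₂ sin θ = h₂₂`, add fresh noise of weight `cos θ` and the relay term of
destination 2. This yields a sequence with the law of `Y₂`, to which the second decoder applies
(`Code.sumRate_bound`).

No differential entropies are used. Fano's inequality takes the form of a change of measure
(`sum_measureReal_mul_log_card_le`): the output laws given each message are compared with one
Gaussian reference measure of covariance `I + P H Hᵀ`, and their average divergence from it is at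
most `n/2 · log det` (`sum_success_mul_log_card_le`). The bounds for the second pair follow by
exchanging the users; dividing by `n` and taking limits and closures concludes. -/

/-! ### Gaussian likelihood ratios, rotations and second moments -/

/-- The logarithm of the ratio of the densities of `N(m, v)` and `N(m', v')` at `y`. -/
noncomputable def gaussianLogRatio (m v m' v' y : ℝ) : ℝ :=
  1 / 2 * Real.log (v' / v) + 1 / 2 * ((y - m') ^ 2 / v') - 1 / 2 * ((y - m) ^ 2 / v)

lemma measurable_gaussianLogRatio (m v m' v' : ℝ) : Measurable (gaussianLogRatio m v m' v') := by
  unfold gaussianLogRatio; fun_prop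

lemma gaussianReal_eq_withDensity (m m' : ℝ) {v v' : NNReal} (hv : v ≠ 0) (hv' : v' ≠ 0) :
    gaussianReal m v = (gaussianReal m' v').withDensity
      (fun y => ENNReal.ofReal (Real.exp (gaussianLogRatio m v m' v' y))) := by
  have hvp : (0 : ℝ) < v := by positivity
  have hvp' : (0 : ℝ) < v' := by positivity
  rw [gaussianReal_of_var_ne_zero _ hv, gaussianReal_of_var_ne_zero _ hv',
    ← withDensity_mul _ (measurable_gaussianPDF _ _)
      ((measurable_gaussianLogRatio _ _ _ _).exp.ennreal_ofReal)]
  congr 1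
  ext y
  simp only [Pi.mul_apply, gaussianPDF]
  rw [← ENNReal.ofReal_mul (gaussianPDFReal_nonneg _ _ _)]
  congr 1
  have hs : ∀ w : ℝ, 0 < w → (√(2 * Real.pi * w))⁻¹ =
      Real.exp (-(1 / 2 * Real.log (2 * Real.pi * w))) := by
    intro w hw
    rw [Real.exp_neg, Real.sqrt_eq_rpow, Real.rpow_def_of_pos (by positivity)]
    congr 2; ring
  rw [gaussianPDFReal, gaussianPDFReal, hs _ hvp, hs _ hvp', ← Real.exp_add, ← Real.exp_add,
    ← Real.exp_add, gaussianLogRatio, Real.log_div hvp'.ne' hvp.ne',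
    Real.log_mul (by positivity) hvp.ne', Real.log_mul (by positivity) hvp'.ne']
  congr 1
  field_simp
  ring

lemma stdGaussian_map_add_eq_withDensity (m m' : ℝ) {b : ℝ} (hb : b ≠ 0) :
    (gaussianReal 0 1).map (fun x => m + x) = ((gaussianReal 0 1).map (fun x => m' + b * x)).withDensity
      (fun y => ENNReal.ofReal (Real.exp (gaussianLogRatio m 1 m' (b ^ 2) y))) := by
  have h1 : (gaussianReal 0 1).map (fun x => m + x) = gaussianReal m 1 := by
    rw [gaussianReal_map_const_add, zero_add]
  have h2 : (gaussianReal 0 1).map (fun x => m' + b * x) = gaussianReal m' ⟨b ^ 2, sq_nonneg b⟩ := by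
    have : (fun x => m' + b * x) = (fun x => m' + x) ∘ (fun x => b * x) := rfl
    rw [this, ← Measure.map_map (by fun_prop) (by fun_prop), gaussianReal_map_const_mul,
      gaussianReal_map_const_add]
    simp
    rfl
  rw [h1, h2, gaussianReal_eq_withDensity m m' one_ne_zero (v' := ⟨b ^ 2, sq_nonneg b⟩)]
  · simp
    rfl
  · intro h
    exact hb (pow_eq_zero_iff two_ne_zero |>.1 (congrArg NNReal.toReal h))

/-- It suffices to test boxes: the indicator of a box times the product density is a product of
functions of single coordinates, and these are independent under the product measure. -/
lemma Measure.pi_withDensity {ι : Type*} [Fintype ι] {α : ι → Type*} [∀ i, MeasurableSpace (α i)]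
    (ν : ∀ i, Measure (α i)) [∀ i, IsProbabilityMeasure (ν i)] (f : ∀ i, α i → ℝ≥0∞)
    (hf : ∀ i, Measurable (f i)) [∀ i, SigmaFinite ((ν i).withDensity (f i))] :
    Measure.pi (fun i => (ν i).withDensity (f i)) =
      (Measure.pi ν).withDensity (fun x => ∏ i, f i (x i)) := by
  refine Measure.pi_eq fun s hs => ?_
  rw [withDensity_apply _ (MeasurableSet.univ_pi hs), ← lintegral_indicator (MeasurableSet.univ_pi hs)]
  have hprod : ∀ x : ∀ i, α i, (Set.univ.pi s).indicator (fun x => ∏ i, f i (x i)) x =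
      ∏ i, (s i).indicator (f i) (x i) := by
    intro x
    by_cases hx : x ∈ Set.univ.pi s
    · rw [Set.indicator_of_mem hx]
      exact Finset.prod_congr rfl fun i _ => (Set.indicator_of_mem (hx i trivial) _).symm
    · rw [Set.indicator_of_notMem hx]
      simp only [Set.mem_univ_pi, not_forall] at hx
      obtain ⟨i, hi⟩ := hx
      exact (Finset.prod_eq_zero (Finset.mem_univ i) (Set.indicator_of_notMem hi _)).symm
  simp_rw [hprod]
  have hind := iIndepFun_pi (μ := ν) (X := fun i => (s i).indicator (f i))
    (fun i => ((hf i).indicator (hs i)).aemeasurable)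
  rw [lintegral_prod_eq_prod_lintegral_of_indepFun Finset.univ _ hind
    (fun i => ((hf i).indicator (hs i)).comp (measurable_pi_apply i))]
  refine Finset.prod_congr rfl fun i _ => ?_
  rw [withDensity_apply _ (hs i), ← lintegral_indicator (hs i)]
  exact (measurePreserving_eval ν i).lintegral_comp ((hf i).indicator (hs i))

/-- The law of `n` independent standard Gaussian variables. -/
noncomputable abbrev stdGaussianPi (n : ℕ) : Measure (Fin n → ℝ) := Measure.pi fun _ => gaussianReal 0 1

/-- Importance sampling: an expectation under unit-variance noise around `m` is rewritten under the
reference noise of variance `b ^ 2` around `m'`. This is the elementary step of every change of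
measure in the converse. -/
lemma lintegral_stdGaussianPi_shift {n : ℕ} (m m' : Fin n → ℝ) {b : ℝ} (hb : b ≠ 0)
    {F : (Fin n → ℝ) → ℝ≥0∞} (hF : Measurable F) :
    ∫⁻ x, F (fun i => m i + x i) ∂(stdGaussianPi n) =
      ∫⁻ x, F (fun i => m' i + b * x i) * ENNReal.ofReal (Real.exp
        (∑ i, gaussianLogRatio (m i) 1 (m' i) (b ^ 2) (m' i + b * x i))) ∂(stdGaussianPi n) := by
  have hprob : ∀ f : ℝ → ℝ, Measurable f → IsProbabilityMeasure ((gaussianReal 0 1).map f) :=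
    fun f hf => Measure.isProbabilityMeasure_map hf.aemeasurable
  have key : (stdGaussianPi n).map (fun x i => m i + x i) =
      ((stdGaussianPi n).map (fun x i => m' i + b * x i)).withDensity
        (fun y => ENNReal.ofReal (Real.exp
          (∑ i, gaussianLogRatio (m i) 1 (m' i) (b ^ 2) (y i)))) := by
    have i1 : ∀ i, IsProbabilityMeasure ((gaussianReal 0 1).map (fun x => m i + x)) :=
      fun i => hprob _ (by fun_prop)
    have i2 : ∀ i, IsProbabilityMeasure ((gaussianReal 0 1).map (fun x => m' i + b * x)) :=
      fun i => hprob _ (by fun_prop)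
    have i3 : ∀ i, SigmaFinite (((gaussianReal 0 1).map (fun x => m' i + b * x)).withDensity
        (fun y => ENNReal.ofReal (Real.exp (gaussianLogRatio (m i) 1 (m' i) (b ^ 2) y)))) := by
      intro i
      rw [← stdGaussian_map_add_eq_withDensity (m i) (m' i) hb]
      have := i1 i
      infer_instance
    rw [Measure.pi_map_pi (f := fun i x => m i + x) (fun i => by fun_prop),
      Measure.pi_map_pi (f := fun i x => m' i + b * x) (fun i => by fun_prop)]
    simp_rw [fun i => stdGaussian_map_add_eq_withDensity (m i) (m' i) hb]
    rw [Measure.pi_withDensity _ _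
      (fun i => (measurable_gaussianLogRatio _ _ _ _).exp.ennreal_ofReal)]
    congr 1
    ext y
    rw [Real.exp_sum, ENNReal.ofReal_prod_of_nonneg (fun i _ => (Real.exp_pos _).le)]
  have hm : Measurable (fun y : Fin n → ℝ => ENNReal.ofReal (Real.exp
      (∑ i, gaussianLogRatio (m i) 1 (m' i) (b ^ 2) (y i)))) :=
    (Finset.measurable_sum _ fun i _ =>
      (measurable_gaussianLogRatio _ _ _ _).comp (measurable_pi_apply i)).exp.ennreal_ofReal
  rw [← lintegral_map hF (by fun_prop), key,
    lintegral_withDensity_eq_lintegral_mul _ hm hF, lintegral_map (hm.mul hF) (by fun_prop)]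
  exact lintegral_congr fun x => mul_comm _ _

lemma lintegral_stdGaussian_shift (m m' : ℝ) {b : ℝ} (hb : b ≠ 0)
    {F : ℝ → ℝ≥0∞} (hF : Measurable F) :
    ∫⁻ x, F (m + x) ∂(gaussianReal 0 1) =
      ∫⁻ x, F (m' + b * x) * ENNReal.ofReal (Real.exp
        (gaussianLogRatio m 1 m' (b ^ 2) (m' + b * x))) ∂(gaussianReal 0 1) := by
  have hm : Measurable (fun y : ℝ => ENNReal.ofReal (Real.exp
      (gaussianLogRatio m 1 m' (b ^ 2) y))) :=
    (measurable_gaussianLogRatio _ _ _ _).exp.ennreal_ofReal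
  rw [← lintegral_map hF (by fun_prop), stdGaussian_map_add_eq_withDensity m m' hb,
    lintegral_withDensity_eq_lintegral_mul _ hm hF, lintegral_map (hm.mul hF) (by fun_prop)]
  exact lintegral_congr fun x => mul_comm _ _

/-- Rotation invariance serves twice: to decorrelate an input from the relay's observation, and to
identify the noise of the simulated output of the other destination. -/
lemma stdGaussian_prod_rotation (θ : ℝ) : MeasurePreserving
    (fun p : ℝ × ℝ => (Real.cos θ * p.1 + Real.sin θ * p.2, -Real.sin θ * p.1 + Real.cos θ * p.2))
    ((gaussianReal 0 1).prod (gaussianReal 0 1)) ((gaussianReal 0 1).prod (gaussianReal 0 1)) where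
  measurable := by fun_prop
  map_eq := by
    have h := IsGaussian.map_rotation_eq_self (μ := gaussianReal 0 1) (by simp) θ
    convert h using 2
    ext p <;> simp [ContinuousLinearMap.rotation_apply]

lemma integrable_stdGaussian_pow (k : ℕ) :
    Integrable (fun x : ℝ => x ^ k) (gaussianReal 0 1) := by
  have h := (memLp_id_gaussianReal (μ := 0) (v := 1) k).integrable_norm_pow'
  rw [← integrable_norm_iff (by fun_prop)]
  simpa using h

lemma integral_sq_stdGaussian : ∫ x, x ^ 2 ∂(gaussianReal 0 1) = 1 := by
  have h := variance_fun_id_gaussianReal (μ := 0) (v := 1)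
  rw [variance_eq_integral (by fun_prop)] at h
  simpa using h

lemma hasIntegral_sq_affine_stdGaussian_prod (α β δ : ℝ) :
    Integrable (fun p : ℝ × ℝ => (α + β * p.1 + δ * p.2) ^ 2)
      ((gaussianReal 0 1).prod (gaussianReal 0 1)) ∧
    ∫ p, (α + β * p.1 + δ * p.2) ^ 2 ∂((gaussianReal 0 1).prod (gaussianReal 0 1)) =
      α ^ 2 + β ^ 2 + δ ^ 2 := by
  set γ := gaussianReal 0 1
  have e : (fun p : ℝ × ℝ => (α + β * p.1 + δ * p.2) ^ 2) = fun p =>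
      α ^ 2 + β ^ 2 * (p.1 ^ 2 * 1) + δ ^ 2 * (1 * p.2 ^ 2) + 2 * α * β * (p.1 ^ 1 * 1)
        + 2 * α * δ * (1 * p.2 ^ 1) + 2 * β * δ * (p.1 ^ 1 * p.2 ^ 1) := by
    ext p; ring
  have h1 : ∀ k, Integrable (fun p : ℝ × ℝ => p.1 ^ k * 1) (γ.prod γ) :=
    fun k => (integrable_stdGaussian_pow k).mul_prod (integrable_const (1 : ℝ))
  have h2 : ∀ k, Integrable (fun p : ℝ × ℝ => 1 * p.2 ^ k) (γ.prod γ) :=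
    fun k => (integrable_const (1 : ℝ)).mul_prod (integrable_stdGaussian_pow k)
  have h3 : Integrable (fun p : ℝ × ℝ => p.1 ^ 1 * p.2 ^ 1) (γ.prod γ) :=
    (integrable_stdGaussian_pow 1).mul_prod (integrable_stdGaussian_pow 1)
  have m1 : ∫ x, x ^ 1 ∂γ = 0 := by simp [γ]
  have m2 : ∫ x, x ^ 2 ∂γ = 1 := integral_sq_stdGaussian
  rw [e]
  have I0 : Integrable (fun _ : ℝ × ℝ => α ^ 2) (γ.prod γ) := integrable_const _
  have I1 := I0.add ((h1 2).const_mul (β ^ 2))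
  have I2 := I1.add ((h2 2).const_mul (δ ^ 2))
  have I3 := I2.add ((h1 1).const_mul (2 * α * β))
  have I4 := I3.add ((h2 1).const_mul (2 * α * δ))
  refine ⟨I4.add (h3.const_mul (2 * β * δ)), ?_⟩
  refine (integral_add' I4 (h3.const_mul (2 * β * δ))).trans ?_
  rw [integral_add' I3 ((h2 1).const_mul _), integral_add' I2 ((h1 1).const_mul _),
    integral_add' I1 ((h2 2).const_mul _), integral_add' I0 ((h1 2).const_mul _)]
  simp only [integral_const_mul, integral_prod_mul (fun x : ℝ => x ^ 2) (fun _ : ℝ => (1 : ℝ)),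
    integral_prod_mul (fun x : ℝ => x ^ 1) (fun _ : ℝ => (1 : ℝ)),
    integral_prod_mul (fun _ : ℝ => (1 : ℝ)) (fun x : ℝ => x ^ 2),
    integral_prod_mul (fun _ : ℝ => (1 : ℝ)) (fun x : ℝ => x ^ 1),
    integral_prod_mul (fun x : ℝ => x ^ 1) (fun x : ℝ => x ^ 1), m1, m2, integral_const]
  simp

/-! ### Conditional mutual information of a Gaussian triple -/

lemma klDiv_of_eq_withDensity_exp {Ω : Type*} [MeasurableSpace Ω] {P Q : Measure Ω}
    [IsProbabilityMeasure P] [IsProbabilityMeasure Q] {f : Ω → ℝ} (hf : Measurable f)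
    (h : P = Q.withDensity (fun ω => ENNReal.ofReal (Real.exp (f ω)))) (hint : Integrable f P) :
    klDiv P Q = ENNReal.ofReal (∫ ω, f ω ∂P) := by
  have hac : P ≪ Q := h ▸ withDensity_absolutelyContinuous _ _
  have hllr : llr P Q =ᵐ[P] f := by
    have h1 : P.rnDeriv Q =ᵐ[Q] fun ω => ENNReal.ofReal (Real.exp (f ω)) := by
      conv_lhs => rw [h]
      exact Measure.rnDeriv_withDensity Q hf.exp.ennreal_ofReal
    filter_upwards [hac.ae_le h1] with ω hω
    rw [llr, hω, ENNReal.toReal_ofReal (Real.exp_pos _).le, Real.log_exp]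
  rw [klDiv_of_ac_of_integrable hac (hint.congr hllr.symm), integral_congr_ae hllr]
  simp

/-- The kernel sending `z` to the law of `φ z + b * N` with `N` standard Gaussian. -/
noncomputable def gaussianShiftKernel {ζ : Type*} [MeasurableSpace ζ] (φ : ζ → ℝ) (b : ℝ) : Kernel ζ ℝ :=
  (Kernel.id ×ₖ Kernel.const ζ (gaussianReal 0 1)).map (fun p => φ p.1 + b * p.2)

section gaussianShiftKernel

variable {ζ : Type*} [MeasurableSpace ζ] {φ : ζ → ℝ}

lemma isMarkovKernel_gaussianShiftKernel (hφ : Measurable φ) (b : ℝ) :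
    IsMarkovKernel (gaussianShiftKernel φ b) :=
  Kernel.IsMarkovKernel.map _ (by fun_prop)

lemma lintegral_gaussianShiftKernel (hφ : Measurable φ) (b : ℝ) (z : ζ) {F : ℝ → ℝ≥0∞}
    (hF : Measurable F) :
    ∫⁻ x, F x ∂(gaussianShiftKernel φ b z) = ∫⁻ g, F (φ z + b * g) ∂(gaussianReal 0 1) := by
  rw [gaussianShiftKernel, Kernel.lintegral_map _ (by fun_prop) _ hF,
    Kernel.lintegral_prod _ _ _ (by fun_prop), Kernel.id_apply, lintegral_dirac' _ (by fun_prop)]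
  simp

end gaussianShiftKernel

/-- Conditional mutual information `I(X; Y | Z)` for `Z = f(G₁)`, `X = a G₁ + b G₂` and
`Y = h X + G₃` with `G₁, G₂, G₃` independent standard Gaussian variables and `f` injective. -/
theorem condMutualInfo_gaussian {Ω ζ : Type*} [MeasurableSpace Ω] [MeasurableSpace ζ]
    (μ : Measure Ω) [IsProbabilityMeasure μ] {X Y : Ω → ℝ} {Z : Ω → ζ}
    (hX : Measurable X) (hY : Measurable Y) (hZ : Measurable Z) {f : ℝ → ζ} {k : ζ → ℝ}
    (hf : Measurable f) (hk : Measurable k) (hkf : ∀ x, k (f x) = x) (a b h : ℝ)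
    (hlaw : μ.map (fun ω => (Z ω, X ω, Y ω)) =
      ((gaussianReal 0 1).prod ((gaussianReal 0 1).prod (gaussianReal 0 1))).map
        (fun g => (f g.1, a * g.1 + b * g.2.1, h * (a * g.1 + b * g.2.1) + g.2.2))) :
    condMutualInfo μ X Y Z = ENNReal.ofReal (1 / 2 * Real.log (1 + h ^ 2 * b ^ 2)) := by
  obtain ⟨I1, v1⟩ := hasIntegral_sq_affine_stdGaussian_prod 0 (h * b) 1
  obtain ⟨I2, v2⟩ := hasIntegral_sq_affine_stdGaussian_prod 0 0 1
  set γ := gaussianReal 0 1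
  have hspos : 0 < 1 + h ^ 2 * b ^ 2 := by positivity
  -- The conditional standard deviation of `Y` given `Z`: the unit noise plus the part `h * b * G₂`
  -- of the signal that `Z` does not reveal.
  set s := √(1 + h ^ 2 * b ^ 2) with hs
  have hs2 : s ^ 2 = 1 + h ^ 2 * b ^ 2 := Real.sq_sqrt hspos.le
  have hs0 : s ≠ 0 := (Real.sqrt_pos.2 hspos).ne'
  have hlint : ∀ F : ζ × ℝ × ℝ → ℝ≥0∞, Measurable F →
      ∫⁻ p, F p ∂(μ.map (fun ω => (Z ω, X ω, Y ω))) = ∫⁻ g₁, ∫⁻ g₂, ∫⁻ g₃,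
        F (f g₁, a * g₁ + b * g₂, h * (a * g₁ + b * g₂) + g₃) ∂γ ∂γ ∂γ := by
    intro F hF
    rw [hlaw, lintegral_map hF (by fun_prop), lintegral_prod _ (by fun_prop)]
    refine lintegral_congr fun g₁ => ?_
    rw [lintegral_prod _ (by fun_prop)]
  have hZlaw : μ.map Z = γ.map f := by
    refine Measure.ext_of_lintegral _ fun F hF => ?_
    have := hlint (fun p => F p.1) (by fun_prop)
    rw [lintegral_map (by fun_prop) (by fun_prop)] at this
    rw [lintegral_map hF hZ, this, lintegral_map hF hf]
    simp
  have hφX : Measurable fun z => a * k z := by fun_prop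
  have hφY : Measurable fun z => h * (a * k z) := by fun_prop
  have := isMarkovKernel_gaussianShiftKernel hφX b
  have := isMarkovKernel_gaussianShiftKernel hφY s
  have hXk : condDistrib X Z μ =ᵐ[μ.map Z] gaussianShiftKernel (fun z => a * k z) b := by
    refine condDistrib_ae_eq_of_measure_eq_compProd Z hX.aemeasurable ?_
    refine Measure.ext_of_lintegral _ fun F hF => ?_
    have e := hlint (fun p => F (p.1, p.2.1)) (by fun_prop)
    rw [lintegral_map (by fun_prop) (by fun_prop)] at e
    rw [lintegral_map hF (by fun_prop), e, Measure.lintegral_compProd hF, hZlaw,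
      lintegral_map hF.lintegral_kernel_prod_right' hf]
    refine lintegral_congr fun g₁ => ?_
    rw [lintegral_gaussianShiftKernel hφX b _ (by fun_prop)]
    simp [hkf, γ]
  have hYk : condDistrib Y Z μ =ᵐ[μ.map Z] gaussianShiftKernel (fun z => h * (a * k z)) s := by
    refine condDistrib_ae_eq_of_measure_eq_compProd Z hY.aemeasurable ?_
    refine Measure.ext_of_lintegral _ fun F hF => ?_
    have e := hlint (fun p => F (p.1, p.2.2)) (by fun_prop)
    rw [lintegral_map (by fun_prop) (by fun_prop)] at e
    rw [lintegral_map hF (by fun_prop), e, Measure.lintegral_compProd hF, hZlaw,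
      lintegral_map hF.lintegral_kernel_prod_right' hf]
    refine lintegral_congr fun g₁ => ?_
    rw [lintegral_gaussianShiftKernel hφY s _ (by fun_prop)]
    simp only [hkf]
    have hsum : (γ.prod γ).map (fun p => h * b * p.1 + p.2) = γ.map (fun x => s * x) := by
      have h1 : (γ.prod γ).map (fun p => h * b * p.1 + p.2) = (γ.map (fun x => h * b * x)) ∗ γ := by
        rw [Measure.conv]
        conv_rhs => rw [← Measure.map_id (μ := γ), Measure.map_id (μ := γ)]
        nth_rewrite 4 [← Measure.map_id (μ := γ)]
        rw [Measure.map_prod_map _ _ (by fun_prop) (by fun_prop),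
          Measure.map_map (by fun_prop) (by fun_prop)]
        rfl
      rw [h1, gaussianReal_map_const_mul, gaussianReal_map_const_mul, gaussianReal_conv_gaussianReal]
      congr 1
      · simp
      · apply NNReal.eq
        simp only [mul_one, NNReal.coe_add, NNReal.coe_one]
        change (h * b) ^ 2 + 1 = s ^ 2
        rw [hs2]; ring
    have hF' : Measurable fun y => F (f g₁, h * (a * g₁) + y) := by fun_prop
    have e2 := lintegral_map (μ := γ) (g := fun x => s * x) hF' (by fun_prop)
    rw [← e2, ← hsum, lintegral_map hF' (by fun_prop), lintegral_prod _ (by fun_prop)]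
    refine lintegral_congr fun g₂ => lintegral_congr fun g₃ => ?_
    congr 2; ring
  set Q := (μ.map Z) ⊗ₘ (gaussianShiftKernel (fun z => a * k z) b ×ₖ
    gaussianShiftKernel (fun z => h * (a * k z)) s) with hQ
  have hQeq : (μ.map Z) ⊗ₘ (condDistrib X Z μ ×ₖ condDistrib Y Z μ) = Q := by
    refine Measure.compProd_congr ?_
    filter_upwards [hXk, hYk] with z hz1 hz2
    rw [Kernel.prod_apply, Kernel.prod_apply, hz1, hz2]
  have hQlint : ∀ F : ζ × ℝ × ℝ → ℝ≥0∞, Measurable F →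
      ∫⁻ p, F p ∂Q = ∫⁻ g₁, ∫⁻ g₂, ∫⁻ g₃,
        F (f g₁, a * g₁ + b * g₂, h * (a * g₁) + s * g₃) ∂γ ∂γ ∂γ := by
    intro F hF
    rw [hQ, Measure.lintegral_compProd hF, hZlaw, lintegral_map hF.lintegral_kernel_prod_right' hf]
    refine lintegral_congr fun g₁ => ?_
    have hG : Measurable fun x =>
        ∫⁻ y, F (f g₁, x, y) ∂(gaussianShiftKernel (fun z => h * (a * k z)) s (f g₁)) :=
      Measurable.lintegral_prod_right' (f := fun p : ℝ × ℝ => F (f g₁, p.1, p.2)) (by fun_prop)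
    rw [Kernel.lintegral_prod _ _ _ (by fun_prop), lintegral_gaussianShiftKernel hφX b _ hG]
    refine lintegral_congr fun g₂ => ?_
    rw [lintegral_gaussianShiftKernel hφY s _ (by fun_prop), hkf]
  set ℓ : ζ × ℝ × ℝ → ℝ := fun p => gaussianLogRatio (h * p.2.1) 1 (h * (a * k p.1)) (s ^ 2) p.2.2
  have hℓ : Measurable ℓ := by simp only [ℓ, gaussianLogRatio]; fun_prop
  have : IsProbabilityMeasure (μ.map Z) := Measure.isProbabilityMeasure_map hZ.aemeasurable
  have : IsProbabilityMeasure (μ.map (fun ω => (Z ω, X ω, Y ω))) :=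
    Measure.isProbabilityMeasure_map (by fun_prop)
  have hPQ : μ.map (fun ω => (Z ω, X ω, Y ω)) =
      Q.withDensity (fun p => ENNReal.ofReal (Real.exp (ℓ p))) := by
    refine Measure.ext_of_lintegral _ fun F hF => ?_
    rw [lintegral_withDensity_eq_lintegral_mul _ hℓ.exp.ennreal_ofReal hF, hlint F hF,
      hQlint _ (hℓ.exp.ennreal_ofReal.mul hF)]
    refine lintegral_congr fun g₁ => lintegral_congr fun g₂ => ?_
    rw [lintegral_stdGaussian_shift _ (h * (a * g₁)) hs0
      (F := fun y => F (f g₁, a * g₁ + b * g₂, y)) (by fun_prop)]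
    refine lintegral_congr fun g₃ => ?_
    simp only [Pi.mul_apply, ℓ, hkf]
    exact mul_comm _ _
  -- The contribution of `g.1` cancels, because both Gaussians are centred at means containing `h *
  -- a * g.1`. The two remaining squares, after normalisation, have mean `1`, so only the logarithm
  -- survives integration.
  have hcomp : ∀ g : ℝ × ℝ × ℝ,
      ℓ (f g.1, a * g.1 + b * g.2.1, h * (a * g.1 + b * g.2.1) + g.2.2) =
      1 / 2 * Real.log (s ^ 2) + 1 / 2 * ((0 + h * b * g.2.1 + 1 * g.2.2) ^ 2 / s ^ 2)
        - 1 / 2 * ((0 + 0 * g.2.1 + 1 * g.2.2) ^ 2) := by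
    intro g
    simp only [ℓ, gaussianLogRatio, hkf, div_one]
    ring_nf
  have hsnd : MeasurePreserving (Prod.snd : ℝ × ℝ × ℝ → ℝ × ℝ) (γ.prod (γ.prod γ)) (γ.prod γ) :=
    measurePreserving_snd
  set φ : ℝ × ℝ → ℝ := fun p => 1 / 2 * Real.log (s ^ 2) +
    1 / 2 * ((0 + h * b * p.1 + 1 * p.2) ^ 2 / s ^ 2) - 1 / 2 * ((0 + 0 * p.1 + 1 * p.2) ^ 2) with hφ
  have J0 : Integrable (fun _ : ℝ × ℝ => 1 / 2 * Real.log (s ^ 2)) (γ.prod γ) := integrable_const _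
  have J1 := J0.add ((I1.div_const (s ^ 2)).const_mul (1 / 2))
  have J2 := I2.const_mul (1 / 2)
  have hφint : Integrable φ (γ.prod γ) := J1.sub J2
  have hφval : ∫ p, φ p ∂(γ.prod γ) = 1 / 2 * Real.log (s ^ 2) := by
    refine (integral_sub' J1 J2).trans ?_
    rw [integral_add' J0 ((I1.div_const (s ^ 2)).const_mul (1 / 2))]
    simp only [integral_const_mul, integral_div, v1, v2, integral_const]
    rw [
      show (0 : ℝ) ^ 2 + (h * b) ^ 2 + 1 ^ 2 = s ^ 2 by rw [hs2]; ring,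
      div_self (pow_ne_zero 2 hs0)]
    simp
  have hint : Integrable ℓ (μ.map (fun ω => (Z ω, X ω, Y ω))) := by
    rw [hlaw, integrable_map_measure hℓ.aestronglyMeasurable (by fun_prop)]
    refine Integrable.congr (hsnd.integrable_comp_of_integrable hφint) (ae_of_all _ fun g => ?_)
    exact (hcomp g).symm
  have hval : ∫ p, ℓ p ∂(μ.map (fun ω => (Z ω, X ω, Y ω))) = 1 / 2 * Real.log (s ^ 2) := by
    have e := integral_map (μ := γ.prod (γ.prod γ)) (f := φ) hsnd.measurable.aemeasurable
      (by rw [hsnd.map_eq]; exact hφint.aestronglyMeasurable)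
    rw [hsnd.map_eq] at e
    rw [hlaw, integral_map (by fun_prop) hℓ.aestronglyMeasurable, ← hφval, e]
    simp_rw [hcomp]
    rfl
  rw [condMutualInfo, hQeq, klDiv_of_eq_withDensity_exp hℓ hPQ hint, hval, hs2]

/-! ### From the strong condition to inequalities between gains -/

namespace GaussianIRC

variable (ch : GaussianIRC)

lemma lintegral_singleLaw_const (p₁ p₂ : Measure ℝ) [IsProbabilityMeasure p₁]
    [IsProbabilityMeasure p₂] {F : Single → ℝ≥0∞} (hF : Measurable F) :
    ∫⁻ ω, F ω ∂(ch.singleLaw p₁ p₂ (Kernel.const ℝ (Measure.dirac 0))) =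
      ∫⁻ x₁, ∫⁻ x₂, ∫⁻ zR, ∫⁻ z₁, ∫⁻ z₂, F (((x₁, x₂, zR), 0), (z₁, z₂))
        ∂(gaussianReal 0 1) ∂(gaussianReal 0 1) ∂(gaussianReal 0 1) ∂p₂ ∂p₁ := by
  rw [singleLaw, lintegral_prod _ (by fun_prop), Measure.lintegral_compProd (by fun_prop)]
  simp only [Kernel.comap_apply, Kernel.const_apply]
  have h : ∀ a : ℝ × ℝ × ℝ, ∫⁻ b, ∫⁻ y, F ((a, b), y)
      ∂((gaussianReal 0 1).prod (gaussianReal 0 1)) ∂(Measure.dirac (0 : Fin 2 → ℝ)) =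
      ∫⁻ z₁, ∫⁻ z₂, F ((a, 0), (z₁, z₂)) ∂(gaussianReal 0 1) ∂(gaussianReal 0 1) := by
    intro a
    rw [lintegral_dirac' _ (Measurable.lintegral_prod_right'
      (f := fun p : (Fin 2 → ℝ) × (ℝ × ℝ) => F ((a, p.1), p.2)) (by fun_prop)),
      lintegral_prod _ (by fun_prop)]
  simp_rw [h]
  have hm : Measurable fun a : ℝ × ℝ × ℝ =>
      ∫⁻ z₁, ∫⁻ z₂, F ((a, 0), (z₁, z₂)) ∂(gaussianReal 0 1) ∂(gaussianReal 0 1) := by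
    refine Measurable.lintegral_prod_right' (f := fun p : (ℝ × ℝ × ℝ) × ℝ =>
      ∫⁻ z₂, F ((p.1, 0), (p.2, z₂)) ∂(gaussianReal 0 1)) ?_
    exact Measurable.lintegral_prod_right' (f := fun p : ((ℝ × ℝ × ℝ) × ℝ) × ℝ =>
      F ((p.1.1, 0), (p.1.2, p.2))) (by fun_prop)
  rw [lintegral_prod _ hm.aemeasurable]
  refine lintegral_congr fun x₁ => ?_
  exact lintegral_prod _ (hm.comp measurable_prodMk_left).aemeasurable

/-- If `X` and `Z` are independent standard Gaussian variables then `X` and `r X + Z` are obtained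
from independent standard Gaussian variables `(g₁, g₂)` by a triangular linear map. -/
lemma lintegral_stdGaussian_triangular (r : ℝ) {F : ℝ → ℝ → ℝ≥0∞}
    (hF : Measurable (Function.uncurry F)) :
    ∫⁻ x, ∫⁻ z, F x (r * x + z) ∂(gaussianReal 0 1) ∂(gaussianReal 0 1) =
      ∫⁻ g₁, ∫⁻ g₂, F (Real.sin (Real.arctan r) * g₁ + Real.cos (Real.arctan r) * g₂)
        (g₁ / Real.cos (Real.arctan r)) ∂(gaussianReal 0 1) ∂(gaussianReal 0 1) := by
  set θ := Real.arctan r with hθ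
  have hc : Real.cos θ ≠ 0 := (Real.cos_arctan_pos r).ne'
  have hr : r * Real.cos θ = Real.sin θ := by
    rw [← Real.tan_mul_cos hc, hθ, Real.tan_arctan]
  have hF2 : ∀ u v : ℝ × ℝ → ℝ, Measurable u → Measurable v → Measurable fun p => F (u p) (v p) :=
    fun u v hu hv => hF.comp (hu.prodMk hv)
  have e1 := (stdGaussian_prod_rotation θ).lintegral_comp (f := fun p => F p.1 (r * p.1 + p.2))
    (hF2 _ _ (by fun_prop) (by fun_prop))
  have e2 : ∫⁻ x, ∫⁻ z, F x (r * x + z) ∂(gaussianReal 0 1) ∂(gaussianReal 0 1) =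
      ∫⁻ p, F p.1 (r * p.1 + p.2) ∂((gaussianReal 0 1).prod (gaussianReal 0 1)) := by
    rw [lintegral_prod _ (hF2 _ _ (by fun_prop) (by fun_prop)).aemeasurable]
  -- With `tan θ = r`, the rotated form of `r * x + z` no longer involves the first coordinate;
  -- integrating the second coordinate outside makes it `g₁`.
  rw [e2, ← e1, lintegral_prod_symm _ (hF2 _ _ (by fun_prop) (by fun_prop)).aemeasurable]
  refine lintegral_congr fun g₁ => lintegral_congr fun g₂ => ?_
  have h1 : Real.sin θ ^ 2 + Real.cos θ ^ 2 = 1 := Real.sin_sq_add_cos_sq θ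
  congr 1
  · ring
  · rw [eq_div_iff hc]
    linear_combination (Real.cos θ * g₂ + Real.sin θ * g₁) * hr + g₁ * h1

/-- The factor `cos² (arctan r) = 1 / (1 + r²)` is the conditional variance of a standard Gaussian
`X` given `r X + Z`, which plays the role of `b ^ 2` in `condMutualInfo_gaussian`. -/
lemma condMutualInfo_gaussian_relay {Ω : Type*} [MeasurableSpace Ω] (μ : Measure Ω)
    [IsProbabilityMeasure μ] {X Y : Ω → ℝ} {Z : Ω → ℝ × ℝ × (Fin 2 → ℝ)} (hX : Measurable X)
    (hY : Measurable Y) (hZ : Measurable Z) (r h : ℝ)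
    (hlaw : ∀ F : (ℝ × ℝ × (Fin 2 → ℝ)) × ℝ × ℝ → ℝ≥0∞, Measurable F →
      ∫⁻ ω, F (Z ω, X ω, Y ω) ∂μ = ∫⁻ x, ∫⁻ z, ∫⁻ w, F ((0, r * x + z, 0), x, h * x + w)
        ∂(gaussianReal 0 1) ∂(gaussianReal 0 1) ∂(gaussianReal 0 1)) :
    condMutualInfo μ X Y Z =
      ENNReal.ofReal (1 / 2 * Real.log (1 + h ^ 2 * Real.cos (Real.arctan r) ^ 2)) := by
  have hc : Real.cos (Real.arctan r) ≠ 0 := (Real.cos_arctan_pos r).ne'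
  refine condMutualInfo_gaussian μ hX hY hZ
    (f := fun g => (0, g / Real.cos (Real.arctan r), 0))
    (k := fun z => z.2.1 * Real.cos (Real.arctan r)) (by fun_prop) (by fun_prop)
    (fun x => div_mul_cancel₀ x hc) (Real.sin (Real.arctan r)) (Real.cos (Real.arctan r)) h ?_
  refine Measure.ext_of_lintegral _ fun F hF => ?_
  have hm : Measurable (Function.uncurry fun x y : ℝ =>
      ∫⁻ w, F ((0, y, 0), x, h * x + w) ∂(gaussianReal 0 1)) :=
    Measurable.lintegral_prod_right' (f := fun p : (ℝ × ℝ) × ℝ =>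
      F ((0, p.1.2, 0), p.1.1, h * p.1.1 + p.2)) (by fun_prop)
  rw [lintegral_map hF (by fun_prop), hlaw F hF, lintegral_stdGaussian_triangular r hm,
    lintegral_map hF (by fun_prop), lintegral_prod _ (by fun_prop)]
  refine lintegral_congr fun g₁ => ?_
  rw [lintegral_prod _ (by fun_prop)]

lemma sq_le_sq_of_ofReal_log_le {a b c : ℝ} (hc : c ≠ 0)
    (h : ENNReal.ofReal (1 / 2 * Real.log (1 + a ^ 2 * c ^ 2)) ≤
      ENNReal.ofReal (1 / 2 * Real.log (1 + b ^ 2 * c ^ 2))) : a ^ 2 ≤ b ^ 2 := by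
  have hb : 0 ≤ Real.log (1 + b ^ 2 * c ^ 2) := Real.log_nonneg (by nlinarith [sq_nonneg (b * c)])
  rw [ENNReal.ofReal_le_ofReal_iff (by positivity)] at h
  have h2 := (Real.log_le_log_iff (by positivity) (by positivity)).1
    (le_of_mul_le_mul_left h (by norm_num))
  have hc2 : 0 < c ^ 2 := by positivity
  exact le_of_mul_le_mul_right (by linarith) hc2

/-- One test distribution per inequality is enough: a standard Gaussian input, the other input and
the relay identically zero. Both sides then equal `½ log (1 + h² c²)` with the same nonzero `c`, so
they are ordered as the squared gains. -/
theorem IsStrong.sq_gain_le {ch : GaussianIRC} (hs : ch.IsStrong) :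
    ch.h11 ^ 2 ≤ ch.h21 ^ 2 ∧ ch.h22 ^ 2 ≤ ch.h12 ^ 2 := by
  have m1 : Measurable Single.x₁ := by unfold Single.x₁; fun_prop
  have m2 : Measurable Single.x₂ := by unfold Single.x₂; fun_prop
  have mR : Measurable Single.xR := by unfold Single.xR; fun_prop
  have mYR : Measurable ch.singleYR := by
    unfold singleYR outR Single.x₁ Single.x₂ Single.zR; fun_prop
  have mY1 : Measurable ch.singleY1 := by
    unfold singleY1 out1 Single.x₁ Single.x₂ Single.xR Single.z₁ dotProduct; fun_prop
  have mY2 : Measurable ch.singleY2 := by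
    unfold singleY2 out2 Single.x₁ Single.x₂ Single.xR Single.z₂ dotProduct; fun_prop
  have hc : ∀ r, Real.cos (Real.arctan r) ≠ 0 := fun r => (Real.cos_arctan_pos r).ne'
  constructor
  · have h := (hs (gaussianReal 0 1) (Measure.dirac 0) (Kernel.const ℝ (Measure.dirac 0))).1
    rw [condMutualInfo_gaussian_relay _ m1 mY1 (by fun_prop) ch.hR1 ch.h11,
      condMutualInfo_gaussian_relay _ m1 mY2 (by fun_prop) ch.hR1 ch.h21] at h
    · exact sq_le_sq_of_ofReal_log_le (hc _) h
    all_goals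
      intro F hF
      rw [lintegral_singleLaw_const _ _ _ (by fun_prop)]
      refine lintegral_congr fun x => ?_
      rw [lintegral_dirac]
      simp [singleYR, singleY1, singleY2, outR, out1, out2, Single.x₁, Single.x₂, Single.zR,
        Single.xR, Single.z₁, Single.z₂]
  · have h := (hs (Measure.dirac 0) (gaussianReal 0 1) (Kernel.const ℝ (Measure.dirac 0))).2
    rw [condMutualInfo_gaussian_relay _ m2 mY2 (by fun_prop) ch.hR2 ch.h22,
      condMutualInfo_gaussian_relay _ m2 mY1 (by fun_prop) ch.hR2 ch.h12] at h
    · exact sq_le_sq_of_ofReal_log_le (hc _) h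
    all_goals
      intro F hF
      rw [lintegral_singleLaw_const _ _ _ (by fun_prop), lintegral_dirac]
      simp [singleYR, singleY1, singleY2, outR, out1, out2, Single.x₁, Single.x₂, Single.zR,
        Single.xR, Single.z₁, Single.z₂]

end GaussianIRC

/-! ### Fano's inequality by change of measure -/

/-- Fano-type bound by change of measure: if the laws `P w` have densities `exp (ℓ w)` with respect
to a common probability measure `Q`, then decoding `w` on disjoint sets `D w` is limited by the
average divergence of the `P w` from `Q`. -/
theorem sum_measureReal_mul_log_card_le {W Ω : Type*} [Fintype W] [Nonempty W] [MeasurableSpace Ω]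
    {Q : Measure Ω} [IsProbabilityMeasure Q] {P : W → Measure Ω} [∀ w, IsProbabilityMeasure (P w)]
    {ℓ : W → Ω → ℝ} (hℓ : ∀ w, Measurable (ℓ w))
    (hP : ∀ w, P w = Q.withDensity (fun ω => ENNReal.ofReal (Real.exp (ℓ w ω))))
    (hint : ∀ w, Integrable (ℓ w) (P w)) {D : W → Set Ω} (hD : ∀ w, MeasurableSet (D w))
    (hdisj : Pairwise fun w w' => Disjoint (D w) (D w')) :
    (∑ w, (P w).real (D w)) * Real.log (Fintype.card W) ≤
      Fintype.card W * Real.log 2 + ∑ w, ∫ ω, ℓ w ω ∂(P w) := by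
  set M : ℝ := ((Fintype.card W : ℕ) : ℝ) with hM
  have hM1 : 1 ≤ M := by
    rw [hM]; exact_mod_cast Fintype.card_pos
  have hMpos : 0 < M := by linarith
  have key : ∀ w, (P w).real (D w) * Real.log M - ∫ ω, ℓ w ω ∂(P w) - Real.log 2 ≤
      1 / 2 * (1 + (M - 1) * Q.real (D w)) - 1 := by
    intro w
    -- The test function of the Donsker–Varadhan argument: `exp g` equals `M` on the decoding set
    -- and `1` elsewhere, so its `Q`-integral is `1 + (M - 1) Q(D w)`.
    set g : Ω → ℝ := (D w).indicator (fun _ => Real.log M) with hg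
    have hgi : Integrable g (P w) := (integrable_const _).indicator (hD w)
    have heg : (fun ω => Real.exp (g ω)) = fun ω => 1 + (D w).indicator (fun _ => M - 1) ω := by
      ext ω
      by_cases hω : ω ∈ D w
      · simp [hg, hω, Real.exp_log hMpos]
      · simp [hg, hω]
    have hsmul : ∀ ω, (ENNReal.ofReal (Real.exp (ℓ w ω))).toReal •
        Real.exp (g ω - ℓ w ω) = 1 + (D w).indicator (fun _ => M - 1) ω := by
      intro ω
      rw [ENNReal.toReal_ofReal (Real.exp_pos _).le, smul_eq_mul, ← Real.exp_add,
        add_sub_cancel, ← congrFun heg ω]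
    have hIQ : Integrable (fun ω => 1 + (D w).indicator (fun _ => M - 1) ω) Q :=
      (integrable_const _).add ((integrable_const _).indicator (hD w))
    have hRint : Integrable (fun ω => Real.exp (g ω - ℓ w ω)) (P w) := by
      rw [hP w, integrable_withDensity_iff_integrable_smul' (hℓ w).exp.ennreal_ofReal
        (ae_of_all _ fun _ => ENNReal.ofReal_lt_top)]
      simp_rw [hsmul]
      exact hIQ
    have hRval : ∫ ω, Real.exp (g ω - ℓ w ω) ∂(P w) = 1 + (M - 1) * Q.real (D w) := by
      rw [hP w, integral_withDensity_eq_integral_toReal_smul (hℓ w).exp.ennreal_ofReal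
        (ae_of_all _ fun _ => ENNReal.ofReal_lt_top)]
      simp_rw [hsmul]
      rw [integral_add (integrable_const _) ((integrable_const _).indicator (hD w)),
        integral_indicator_const _ (hD w)]
      simp [mul_comm]
    -- The inequality `x + 1 ≤ exp x` shifted by `log 2`; the resulting factor `1 / 2` is what
    -- absorbs the sum over messages.
    have hpt : ∀ ω, g ω - ℓ w ω - Real.log 2 ≤ 1 / 2 * Real.exp (g ω - ℓ w ω) - 1 := by
      intro ω
      have := Real.add_one_le_exp (g ω - ℓ w ω - Real.log 2)
      rw [Real.exp_sub _ (Real.log 2), Real.exp_log (by norm_num)] at this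
      linarith
    have hmono := integral_mono (((hgi.sub (hint w)).sub (integrable_const (Real.log 2))))
      ((hRint.const_mul (1 / 2)).sub (integrable_const (1 : ℝ))) hpt
    rw [integral_sub' (hgi.sub (hint w)) (integrable_const _), integral_sub' hgi (hint w),
      integral_sub' (hRint.const_mul _) (integrable_const _), integral_const_mul, hRval, hg,
      integral_indicator_const _ (hD w)] at hmono
    simpa using hmono
  have hQ : ∑ w, Q.real (D w) ≤ 1 := by
    rw [← measureReal_biUnion_finset (fun w _ w' _ h => hdisj h) (fun w _ => hD w)]
    exact measureReal_le_one
  have hsum := Finset.sum_le_sum fun w (_ : w ∈ Finset.univ) => key w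
  simp only [Finset.sum_sub_distrib, ← Finset.sum_mul, ← Finset.mul_sum, Finset.sum_add_distrib,
    Finset.sum_const, Finset.card_univ, nsmul_eq_mul, ← hM] at hsum
  -- Disjointness gives total `Q`-mass at most `1`, so the right-hand sides sum to at most `M / 2 +
  -- (M - 1) / 2 - M < 0`.
  nlinarith [mul_le_mul_of_nonneg_left hQ (sub_nonneg.2 hM1)]

/-! ### Likelihood ratio of the block outputs against a Gaussian reference -/

namespace GaussianIRC

instance (n : ℕ) : IsProbabilityMeasure (noiseLaw n) := by
  unfold noiseLaw; infer_instance

lemma measurePreserving_noise_eval {n : ℕ} (i : Fin n) :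
    MeasurePreserving (fun z : Noise n => (z.1 i, z.2.1 i)) (noiseLaw n)
      ((gaussianReal 0 1).prod (gaussianReal 0 1)) := by
  have h1 := measurePreserving_eval (fun _ : Fin n => gaussianReal 0 1) i
  have h2 : MeasurePreserving (Prod.fst : (Fin n → ℝ) × (Fin n → ℝ) → (Fin n → ℝ))
      ((stdGaussianPi n).prod (stdGaussianPi n)) (stdGaussianPi n) := measurePreserving_fst
  exact h1.prod (h1.comp h2)

/-- Affine map of the noise used to build the reference measure in the converse. -/
def refMap {n : ℕ} (v u : Fin n → ℝ) (a c b : ℝ) (z : Noise n) : Noise n :=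
  (fun i => v i + a * z.1 i, fun i => (u i + c * (a * z.1 i)) + b * z.2.1 i, z.2.2)

/-- Log-likelihood ratio between the law of `noise + (v, u, 0)` and that of
`refMap v' u' a c b noise`. -/
noncomputable def noiseLogRatio {n : ℕ} (v u v' u' : Fin n → ℝ) (a c b : ℝ) (y : Noise n) : ℝ :=
  ∑ i, gaussianLogRatio (v i) 1 (v' i) (a ^ 2) (y.1 i) +
    ∑ i, gaussianLogRatio (u i) 1 (u' i + c * (y.1 i - v' i)) (b ^ 2) (y.2.1 i)

lemma measurable_refMap {n : ℕ} (v u : Fin n → ℝ) (a c b : ℝ) : Measurable (refMap v u a c b) := by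
  unfold refMap; fun_prop

lemma measurable_noiseLogRatio {n : ℕ} (v u v' u' : Fin n → ℝ) (a c b : ℝ) :
    Measurable (noiseLogRatio v u v' u' a c b) := by
  unfold noiseLogRatio gaussianLogRatio; fun_prop

/-- Shift of the noise by the signal `(v, u)`. -/
def shiftMap {n : ℕ} (v u : Fin n → ℝ) (z : Noise n) : Noise n :=
  (fun i => v i + z.1 i, fun i => u i + z.2.1 i, z.2.2)

lemma measurable_shiftMap {n : ℕ} (v u : Fin n → ℝ) : Measurable (shiftMap v u) := by
  unfold shiftMap; fun_prop

/-- Chain rule for densities: change the relay coordinate first, then the destination coordinate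
conditionally on it, its reference mean being shifted by the regression term with slope `c`. The
third coordinate has the same law on both sides and carries no density. -/
lemma map_shiftMap_eq_withDensity {n : ℕ} (v u v' u' : Fin n → ℝ) {a b : ℝ} (c : ℝ) (ha : a ≠ 0)
    (hb : b ≠ 0) :
    (noiseLaw n).map (shiftMap v u) = ((noiseLaw n).map (refMap v' u' a c b)).withDensity
      (fun y => ENNReal.ofReal (Real.exp (noiseLogRatio v u v' u' a c b y))) := by
  refine Measure.ext_of_lintegral _ fun F hF => ?_
  have hm := (measurable_noiseLogRatio v u v' u' a c b).exp.ennreal_ofReal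
  have hs := measurable_shiftMap v u
  have hr := measurable_refMap v' u' a c b
  have hFs : Measurable fun z => F (shiftMap v u z) := hF.comp hs
  set G := (fun y => ENNReal.ofReal (Real.exp (noiseLogRatio v u v' u' a c b y))) * F with hGdef
  have hGr : Measurable fun z => G (refMap v' u' a c b z) := (hm.mul hF).comp hr
  rw [lintegral_withDensity_eq_lintegral_mul _ hm hF, lintegral_map (hm.mul hF) hr,
    lintegral_map hF hs, noiseLaw, lintegral_prod _ hFs.aemeasurable,
    lintegral_prod _ hGr.aemeasurable]
  set γ := stdGaussianPi n
  have hG : Measurable fun y₁ : Fin n → ℝ => ∫⁻ y, F (y₁, fun i => u i + y.1 i, y.2) ∂(γ.prod γ) :=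
    Measurable.lintegral_prod_right' (f := fun p : (Fin n → ℝ) × (Fin n → ℝ) × (Fin n → ℝ) =>
      F (p.1, fun i => u i + p.2.1 i, p.2.2)) (by fun_prop)
  refine (lintegral_stdGaussianPi_shift v v' ha hG).trans (lintegral_congr fun x => ?_)
  set y₁ : Fin n → ℝ := fun i => v' i + a * x i with hy₁
  have hGx : Measurable fun y : (Fin n → ℝ) × (Fin n → ℝ) => G (refMap v' u' a c b (x, y)) :=
    hGr.comp measurable_prodMk_left
  rw [lintegral_prod_symm _ (by fun_prop), lintegral_prod_symm _ hGx.aemeasurable,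
    ← lintegral_mul_const]
  · refine lintegral_congr fun x₃ => ?_
    have := lintegral_stdGaussianPi_shift u (fun i => u' i + c * (a * x i)) hb
      (F := fun y => F (y₁, y, x₃)) (by fun_prop)
    refine (congrArg (· * _) this).trans ?_
    rw [← lintegral_mul_const _ (by
      have : Measurable fun y : Fin n → ℝ => ∑ i, gaussianLogRatio (u i) 1 (u' i + c * (a * x i))
          (b ^ 2) (u' i + c * (a * x i) + b * y i) := by unfold gaussianLogRatio; fun_prop
      exact Measurable.mul (by fun_prop) this.exp.ennreal_ofReal)]
    refine lintegral_congr fun x₂ => ?_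
    simp only [hGdef, Pi.mul_apply, refMap, noiseLogRatio, y₁, add_sub_cancel_left, Real.exp_add]
    rw [ENNReal.ofReal_mul (Real.exp_pos _).le, mul_assoc, mul_comm]
    congr 1
    rw [mul_comm]
  · exact Measurable.lintegral_prod_left' (f := fun p : (Fin n → ℝ) × (Fin n → ℝ) =>
      F (y₁, fun i => u i + p.1 i, p.2)) (by fun_prop)

/-- Summed over `i`, this is the divergence of the true output law from the reference. The extra `c
^ 2` is relay noise entering through the regression residual; the final `-1` is half the variance of
each of the two unit noises. -/
lemma integral_noiseLogRatio {n : ℕ} (v u v' u' : Fin n → ℝ) {a b : ℝ} (c : ℝ) :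
    Integrable (noiseLogRatio v u v' u' a c b) ((noiseLaw n).map (shiftMap v u)) ∧
    ∫ y, noiseLogRatio v u v' u' a c b y ∂((noiseLaw n).map (shiftMap v u)) =
      ∑ i, (1 / 2 * Real.log (a ^ 2) + 1 / 2 * (((v i - v' i) ^ 2 + 1) / a ^ 2) +
        (1 / 2 * Real.log (b ^ 2) +
          1 / 2 * ((((u i - u' i) - c * (v i - v' i)) ^ 2 + 1 + c ^ 2) / b ^ 2)) - 1) := by
  have hm := measurable_noiseLogRatio v u v' u' a c b
  have hs := measurable_shiftMap v u
  set φ : Fin n → ℝ × ℝ → ℝ := fun i p =>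
    1 / 2 * Real.log (a ^ 2) + 1 / 2 * (((v i - v' i) + 1 * p.1 + 0 * p.2) ^ 2 / a ^ 2)
      + (1 / 2 * Real.log (b ^ 2) +
        1 / 2 * (((u i - u' i) - c * (v i - v' i) + (-c) * p.1 + 1 * p.2) ^ 2 / b ^ 2))
      - (1 / 2 * (0 + 1 * p.1 + 0 * p.2) ^ 2 + 1 / 2 * (0 + 0 * p.1 + 1 * p.2) ^ 2) with hφ
  have hcomp : ∀ z, noiseLogRatio v u v' u' a c b (shiftMap v u z) =
      ∑ i, φ i (z.1 i, z.2.1 i) := by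
    intro z
    rw [noiseLogRatio, ← Finset.sum_add_distrib]
    refine Finset.sum_congr rfl fun i _ => ?_
    simp only [gaussianLogRatio, shiftMap, hφ, div_one]
    ring
  have hφ2 : ∀ i, Integrable (φ i) ((gaussianReal 0 1).prod (gaussianReal 0 1)) ∧
      ∫ p, φ i p ∂((gaussianReal 0 1).prod (gaussianReal 0 1)) =
        1 / 2 * Real.log (a ^ 2) + 1 / 2 * (((v i - v' i) ^ 2 + 1) / a ^ 2) +
        (1 / 2 * Real.log (b ^ 2) +
          1 / 2 * ((((u i - u' i) - c * (v i - v' i)) ^ 2 + 1 + c ^ 2) / b ^ 2)) - 1 := by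
    intro i
    obtain ⟨I1, e1⟩ := hasIntegral_sq_affine_stdGaussian_prod (v i - v' i) 1 0
    obtain ⟨I2, e2⟩ := hasIntegral_sq_affine_stdGaussian_prod
      ((u i - u' i) - c * (v i - v' i)) (-c) 1
    obtain ⟨I3, e3⟩ := hasIntegral_sq_affine_stdGaussian_prod 0 1 0
    obtain ⟨I4, e4⟩ := hasIntegral_sq_affine_stdGaussian_prod 0 0 1
    set γ := (gaussianReal 0 1).prod (gaussianReal 0 1)
    have K1 : Integrable (fun _ : ℝ × ℝ => 1 / 2 * Real.log (a ^ 2)) γ := integrable_const _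
    have K2 : Integrable (fun _ : ℝ × ℝ => 1 / 2 * Real.log (b ^ 2)) γ := integrable_const _
    have L1 := (I1.div_const (a ^ 2)).const_mul (1 / 2)
    have L2 := (I2.div_const (b ^ 2)).const_mul (1 / 2)
    have L3 := I3.const_mul (1 / 2)
    have L4 := I4.const_mul (1 / 2)
    refine ⟨((K1.add L1).add (K2.add L2)).sub (L3.add L4), ?_⟩
    refine (integral_sub' ((K1.add L1).add (K2.add L2)) (L3.add L4)).trans ?_
    rw [integral_add' (K1.add L1) (K2.add L2), integral_add' K1 L1, integral_add' K2 L2,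
      integral_add' L3 L4]
    simp only [integral_const_mul, integral_div, e1, e2, e3, e4, integral_const]
    simp
    ring
  have hev := fun i : Fin n => measurePreserving_noise_eval i
  have hI : ∀ i, Integrable (fun z : Noise n => φ i (z.1 i, z.2.1 i)) (noiseLaw n) :=
    fun i => (hev i).integrable_comp_of_integrable (hφ2 i).1
  constructor
  · rw [integrable_map_measure hm.aestronglyMeasurable hs.aemeasurable]
    exact (integrable_finsetSum _ fun i _ => hI i).congr (ae_of_all _ fun z => (hcomp z).symm)
  · rw [integral_map hs.aemeasurable hm.aestronglyMeasurable]
    simp_rw [hcomp]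
    rw [integral_finsetSum _ fun i _ => hI i]
    refine Finset.sum_congr rfl fun i _ => ?_
    rw [← (hφ2 i).2]
    have e := integral_map (μ := noiseLaw n) (f := φ i) (hev i).measurable.aemeasurable
      (by rw [(hev i).map_eq]; exact (hφ2 i).1.aestronglyMeasurable)
    rw [(hev i).map_eq] at e
    exact e.symm

end GaussianIRC

/-! ### Converse for the two-output Gaussian channel -/

namespace GaussianIRC

/-- Converse for a Gaussian channel with two real outputs per channel use and signals
`v₀ + r₁ x₁ + r₂ x₂`, `u₀ + l₁ x₁ + l₂ x₂`, where `x₁, x₂` are uncorrelated of power at most `P`. -/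
theorem sum_success_mul_log_card_le {n : ℕ} {W : Type*} [Fintype W] [Nonempty W]
    (x₁ x₂ : W → Fin n → ℝ) (v₀ u₀ : Fin n → ℝ) (r₁ r₂ l₁ l₂ : ℝ) {P : ℝ} (hP : 0 ≤ P)
    (h₁ : ∑ w, ∑ i, x₁ w i ^ 2 ≤ Fintype.card W * (n * P))
    (h₂ : ∑ w, ∑ i, x₂ w i ^ 2 ≤ Fintype.card W * (n * P))
    (h₁₂ : ∑ w, ∑ i, x₁ w i * x₂ w i = 0)
    {D : W → Set (Noise n)} (hD : ∀ w, MeasurableSet (D w))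
    (hdisj : Pairwise fun w w' => Disjoint (D w) (D w')) :
    (∑ w, (noiseLaw n).real ((shiftMap (fun i => v₀ i + r₁ * x₁ w i + r₂ * x₂ w i)
        (fun i => u₀ i + l₁ * x₁ w i + l₂ * x₂ w i)) ⁻¹' D w)) * Real.log (Fintype.card W) ≤
      Fintype.card W * (Real.log 2 + n * (1 / 2 * Real.log
        ((1 + (l₁ ^ 2 + l₂ ^ 2) * P) * (1 + (r₁ ^ 2 + r₂ ^ 2) * P)
          - (l₁ * r₁ + l₂ * r₂) ^ 2 * P ^ 2))) := by
  set det := (1 + (l₁ ^ 2 + l₂ ^ 2) * P) * (1 + (r₁ ^ 2 + r₂ ^ 2) * P)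
    - (l₁ * r₁ + l₂ * r₂) ^ 2 * P ^ 2 with hdet
  set M : ℝ := ((Fintype.card W : ℕ) : ℝ) with hM
  have hMpos : 0 < M := by rw [hM]; exact_mod_cast Fintype.card_pos
  have hdet0 : 0 < det := by
    have : det = 1 + (l₁ ^ 2 + l₂ ^ 2) * P + (r₁ ^ 2 + r₂ ^ 2) * P +
        (l₁ * r₂ - l₂ * r₁) ^ 2 * P ^ 2 := by rw [hdet]; ring
    rw [this]; positivity
  -- Triangular factorisation of the covariance `I + P H Hᵀ`: `s` is the variance of the relay
  -- output, `c` the regression coefficient of the destination output on it, `t` the residual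
  -- variance, and `t * s = det`.
  set s := 1 + (r₁ ^ 2 + r₂ ^ 2) * P with hs
  have hs0 : 0 < s := by positivity
  set t := det / s with ht
  have ht0 : 0 < t := by positivity
  set c := (l₁ * r₁ + l₂ * r₂) * P / s with hc
  have hcs : c * s = (l₁ * r₁ + l₂ * r₂) * P := div_mul_cancel₀ _ hs0.ne'
  have hts : t * s = det := div_mul_cancel₀ _ hs0.ne'
  have ht2 : t = 1 + c ^ 2 + ((l₁ - c * r₁) ^ 2 + (l₂ - c * r₂) ^ 2) * P := by
    apply mul_right_cancel₀ hs0.ne'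
    rw [hts, hdet]
    linear_combination (-(c * s) + (l₁ * r₁ + l₂ * r₂) * P) * hcs
  -- Vanishing correlation removes the cross term, so any linear combination of the two inputs obeys
  -- a power bound.
  have hsq : ∀ (α β : ℝ), ∑ w, ∑ i, (α * x₁ w i + β * x₂ w i) ^ 2 ≤
      (α ^ 2 + β ^ 2) * (M * (n * P)) := by
    intro α β
    have e : ∑ w, ∑ i, (α * x₁ w i + β * x₂ w i) ^ 2 = α ^ 2 * ∑ w, ∑ i, x₁ w i ^ 2 +
        β ^ 2 * ∑ w, ∑ i, x₂ w i ^ 2 + 2 * α * β * ∑ w, ∑ i, x₁ w i * x₂ w i := by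
      simp only [Finset.mul_sum, ← Finset.sum_add_distrib]
      refine Finset.sum_congr rfl fun w _ => Finset.sum_congr rfl fun i _ => ?_
      ring
    rw [e, h₁₂]
    nlinarith [mul_le_mul_of_nonneg_left h₁ (sq_nonneg α),
      mul_le_mul_of_nonneg_left h₂ (sq_nonneg β)]
  have ha : √s ≠ 0 := (Real.sqrt_pos.2 hs0).ne'
  have hb : √t ≠ 0 := (Real.sqrt_pos.2 ht0).ne'
  have hprob : ∀ f : Noise n → Noise n, Measurable f → IsProbabilityMeasure ((noiseLaw n).map f) :=
    fun f hf => Measure.isProbabilityMeasure_map hf.aemeasurable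
  have := hprob _ (measurable_refMap v₀ u₀ (√s) c (√t))
  set v : W → Fin n → ℝ := fun w i => v₀ i + r₁ * x₁ w i + r₂ * x₂ w i with hv
  set u : W → Fin n → ℝ := fun w i => u₀ i + l₁ * x₁ w i + l₂ * x₂ w i with hu
  have := fun w => hprob _ (measurable_shiftMap (v w) (u w))
  have hI := fun w => integral_noiseLogRatio (v w) (u w) v₀ u₀ (a := √s) (b := √t) c
  have key := sum_measureReal_mul_log_card_le
    (fun w => measurable_noiseLogRatio (v w) (u w) v₀ u₀ (√s) c (√t))
    (fun w => map_shiftMap_eq_withDensity (v w) (u w) v₀ u₀ c ha hb) (fun w => (hI w).1) hD hdisj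
  have hreal : ∀ w, ((noiseLaw n).map (shiftMap (v w) (u w))).real (D w) =
      (noiseLaw n).real (shiftMap (v w) (u w) ⁻¹' D w) :=
    fun w => map_measureReal_apply (measurable_shiftMap (v w) (u w)) (hD w)
  simp only [fun w => (hI w).2, Real.sq_sqrt hs0.le, Real.sq_sqrt ht0.le, hreal] at key
  refine key.trans ?_
  rw [mul_add]
  refine add_le_add_right ?_ _
  have e : ∑ w, ∑ i, (1 / 2 * Real.log s + 1 / 2 * (((v w i - v₀ i) ^ 2 + 1) / s) +
      (1 / 2 * Real.log t +
        1 / 2 * (((u w i - u₀ i - c * (v w i - v₀ i)) ^ 2 + 1 + c ^ 2) / t)) - 1) =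
      M * n * (1 / 2 * Real.log s + 1 / 2 * Real.log t + 1 / 2 * (1 / s) +
        1 / 2 * ((1 + c ^ 2) / t) - 1) +
      1 / 2 * (∑ w, ∑ i, (r₁ * x₁ w i + r₂ * x₂ w i) ^ 2) / s +
      1 / 2 * (∑ w, ∑ i, ((l₁ - c * r₁) * x₁ w i + (l₂ - c * r₂) * x₂ w i) ^ 2) / t := by
    have e1 : M * n * (1 / 2 * Real.log s + 1 / 2 * Real.log t + 1 / 2 * (1 / s) +
        1 / 2 * ((1 + c ^ 2) / t) - 1) = ∑ _w : W, ∑ _i : Fin n, (1 / 2 * Real.log s +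
        1 / 2 * Real.log t + 1 / 2 * (1 / s) + 1 / 2 * ((1 + c ^ 2) / t) - 1) := by
      simp only [Finset.sum_const, Finset.card_univ, Fintype.card_fin, nsmul_eq_mul, hM]
      ring
    rw [e1]
    simp only [Finset.mul_sum, Finset.sum_div, ← Finset.sum_add_distrib]
    refine Finset.sum_congr rfl fun w _ => Finset.sum_congr rfl fun i _ => ?_
    simp only [hv, hu]
    ring
  have b1 : 1 / 2 * (∑ w, ∑ i, (r₁ * x₁ w i + r₂ * x₂ w i) ^ 2) / s ≤
      1 / 2 * ((s - 1) * (M * n)) / s := by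
    gcongr
    refine (hsq r₁ r₂).trans_eq ?_
    rw [hs]; ring
  have b2 : 1 / 2 * (∑ w, ∑ i, ((l₁ - c * r₁) * x₁ w i + (l₂ - c * r₂) * x₂ w i) ^ 2) / t ≤
      1 / 2 * ((t - 1 - c ^ 2) * (M * n)) / t := by
    gcongr
    refine (hsq _ _).trans_eq ?_
    rw [ht2]; ring
  rw [e]
  have hlog : Real.log det = Real.log t + Real.log s := by
    rw [← hts, Real.log_mul ht0.ne' hs0.ne']
  -- With the reference variances matched to full power, the quadratic terms add up to at most the
  -- `1` subtracted per symbol, leaving only `½ log s + ½ log t`.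
  have c1 : 1 / 2 * ((s - 1) * (M * n)) / s = M * n * (1 / 2 - 1 / 2 * (1 / s)) := by
    field_simp
  have c2 : 1 / 2 * ((t - 1 - c ^ 2) * (M * n)) / t = M * n * (1 / 2 - 1 / 2 * ((1 + c ^ 2) / t)) := by
    field_simp
    ring
  rw [c1] at b1
  rw [c2] at b2
  rw [hlog]
  linarith

/-! ### Noise symmetries, removal of the relay, and centring of codebooks -/

lemma measurePreserving_rotation_pi (n : ℕ) (θ : ℝ) : MeasurePreserving
    (fun p : (Fin n → ℝ) × (Fin n → ℝ) =>
      ((fun i => Real.cos θ * p.1 i + Real.sin θ * p.2 i : Fin n → ℝ),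
        (fun i => -Real.sin θ * p.1 i + Real.cos θ * p.2 i : Fin n → ℝ)))
    ((stdGaussianPi n).prod (stdGaussianPi n)) ((stdGaussianPi n).prod (stdGaussianPi n)) := by
  have e := measurePreserving_arrowProdEquivProdArrow ℝ ℝ (Fin n) (fun _ => gaussianReal 0 1)
    (fun _ => gaussianReal 0 1)
  have r := measurePreserving_pi (fun _ : Fin n => (gaussianReal 0 1).prod (gaussianReal 0 1))
    (fun _ => (gaussianReal 0 1).prod (gaussianReal 0 1)) (fun _ => stdGaussian_prod_rotation θ)
  exact e.comp (r.comp e.symm)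

lemma measurePreserving_noise_rotation (n : ℕ) (θ : ℝ) : MeasurePreserving
    (fun z : Noise n => ((z.1, (fun i => Real.cos θ * z.2.1 i + Real.sin θ * z.2.2 i),
      (fun i => -Real.sin θ * z.2.1 i + Real.cos θ * z.2.2 i)) : Noise n))
    (noiseLaw n) (noiseLaw n) :=
  (MeasurePreserving.id _).prod (measurePreserving_rotation_pi n θ)

lemma measurePreserving_noise_swap (n : ℕ) : MeasurePreserving
    (fun z : Noise n => ((z.1, z.2.2, z.2.1) : Noise n)) (noiseLaw n) (noiseLaw n) :=
  (MeasurePreserving.id _).prod Measure.measurePreserving_swap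

namespace Code

variable (ch : GaussianIRC) {M₁ M₂ n : ℕ} (c : Code M₁ M₂ n)

/-- The relay's transmitted sequence as a function of its received sequence. -/
def relayOut (y : Fin n → ℝ) (i : Fin n) : Fin 2 → ℝ :=
  c.relay i (fun j => y (Fin.castLE i.isLt j))

/-- Adds to `u` the relay's contribution through the gain vector `g`. -/
def addRelay (g : Fin 2 → ℝ) (y u : Fin n → ℝ) (i : Fin n) : ℝ := u i + g ⬝ᵥ c.relayOut y i

lemma measurable_addRelay (g : Fin 2 → ℝ) {Ω : Type*} [MeasurableSpace Ω] {y u : Ω → Fin n → ℝ}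
    (hy : Measurable y) (hu : Measurable u) : Measurable fun ω => c.addRelay g (y ω) (u ω) := by
  refine measurable_pi_lambda _ fun i => ?_
  have h1 : Measurable fun ω => c.relayOut (y ω) i :=
    (c.measurable_relay i).comp (measurable_pi_lambda _ fun j => (measurable_pi_apply _).comp hy)
  simp only [addRelay, dotProduct]
  fun_prop

/-- This makes the relay harmless: from its received sequence and the relay-free output, the true
output of destination 1 can be rebuilt, whatever the relay functions are. -/
lemma addRelay_eq_seqY1 (m₁ : Fin M₁) (m₂ : Fin M₂) (z : Noise n) {v u : Fin n → ℝ}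
    (hv : ∀ i, v i = ch.hR1 * c.enc₁ m₁ i + ch.hR2 * c.enc₂ m₂ i)
    (hu : ∀ i, u i = ch.h11 * c.enc₁ m₁ i + ch.h12 * c.enc₂ m₂ i) :
    c.addRelay ch.h1R (shiftMap v u z).1 (shiftMap v u z).2.1 = c.seqY1 ch m₁ m₂ z := by
  ext i
  simp only [addRelay, relayOut, shiftMap, hv, hu, seqY1, seqXR, seqYR, outR, out1]
  ring

/-- Centring the codewords does not increase power, and it makes the inputs of the two users
uncorrelated under independent uniform messages. The means are absorbed into the known offsets. -/
lemma exists_mean {M n : ℕ} (x : Fin M → Fin n → ℝ) : ∃ μ : Fin n → ℝ,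
    (∀ i, ∑ m, (x m i - μ i) = 0) ∧ ∑ m, ∑ i, (x m i - μ i) ^ 2 ≤ ∑ m, ∑ i, x m i ^ 2 := by
  rcases Nat.eq_zero_or_pos M with rfl | hM
  · exact ⟨0, by simp, by simp⟩
  have hM' : (M : ℝ) ≠ 0 := by positivity
  refine ⟨fun i => (∑ m, x m i) / M, fun i => ?_, ?_⟩
  · simp [Finset.sum_sub_distrib, mul_div_cancel₀ _ hM']
  · rw [Finset.sum_comm, Finset.sum_comm (f := fun m i => x m i ^ 2)]
    refine Finset.sum_le_sum fun i _ => ?_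
    have : ∑ m, (x m i - (∑ m, x m i) / M) ^ 2 = ∑ m, x m i ^ 2 - (∑ m, x m i) ^ 2 / M := by
      simp only [sub_sq, Finset.sum_add_distrib, Finset.sum_sub_distrib, ← Finset.sum_mul,
        ← Finset.mul_sum, Finset.sum_const, Finset.card_univ, Fintype.card_fin, nsmul_eq_mul]
      field_simp
      ring
    rw [this]
    have : 0 ≤ (∑ m, x m i) ^ 2 / M := by positivity
    linarith

end Code

end GaussianIRC

/-! ### Rate bounds for a single code -/

namespace GaussianIRC

namespace Code

variable (ch : GaussianIRC) {M₁ M₂ n : ℕ} (c : Code M₁ M₂ n)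

/-- The event that at least one of the two decoders fails. -/
def errorSet (m₁ : Fin M₁) (m₂ : Fin M₂) : Set (Noise n) :=
  {z | ¬ (c.dec₁ (c.seqY1 ch m₁ m₂ z) = some m₁ ∧ c.dec₂ (c.seqY2 ch m₁ m₂ z) = some m₂)}

lemma sum_errorSet (h₁ : M₁ ≠ 0) (h₂ : M₂ ≠ 0) :
    ∑ m₁, ∑ m₂, (noiseLaw n).real (c.errorSet ch m₁ m₂) = M₁ * M₂ * c.errorProb ch := by
  have : (M₁ * M₂ : ℝ) ≠ 0 := by positivity
  rw [errorProb, mul_inv_cancel_left₀ this]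
  rfl

lemma measurable_seqY2 (m₁ : Fin M₁) (m₂ : Fin M₂) : Measurable (c.seqY2 ch m₁ m₂) := by
  refine measurable_pi_lambda _ fun i => ?_
  have h1 : Measurable fun z : Noise n => c.seqXR ch m₁ m₂ z i := by
    refine (c.measurable_relay i).comp (measurable_pi_lambda _ fun j => ?_)
    simp only [seqYR, outR]
    fun_prop
  simp only [seqY2, out2, dotProduct]
  fun_prop

/-- Single-user converse for the first source, given the second message. -/
theorem rate₁_bound {P : ℝ} (hP : 0 ≤ P) (h₁ : M₁ ≠ 0) (h₂ : M₂ ≠ 0)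
    (hpow : (M₁ : ℝ)⁻¹ * ∑ m₁, ∑ i, c.enc₁ m₁ i ^ 2 ≤ n * P) :
    (1 - c.errorProb ch) * Real.log M₁ ≤ Real.log 2 +
      n * (1 / 2 * Real.log (1 + (ch.h11 ^ 2 + ch.hR1 ^ 2) * P)) := by
  have : NeZero M₁ := ⟨h₁⟩
  have hM₁ : (0 : ℝ) < M₁ := by positivity
  have hM₂ : (0 : ℝ) < M₂ := by positivity
  rw [inv_mul_le_iff₀ hM₁] at hpow
  obtain ⟨μ, hμ, hvar⟩ := exists_mean c.enc₁
  have hlog : 0 ≤ Real.log M₁ := Real.log_natCast_nonneg _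
  have hm₂ : ∀ m₂, (M₁ - ∑ m₁, (noiseLaw n).real (c.errorSet ch m₁ m₂)) * Real.log M₁ ≤
      M₁ * (Real.log 2 + n * (1 / 2 * Real.log (1 + (ch.h11 ^ 2 + ch.hR1 ^ 2) * P))) := by
    intro m₂
    set D : Fin M₁ → Set (Noise n) := fun m₁ =>
      (fun y => c.addRelay ch.h1R y.1 y.2.1) ⁻¹' (c.dec₁ ⁻¹' {some m₁}) with hDdef
    have hD : ∀ m, MeasurableSet (D m) := fun m =>
      c.measurable_addRelay ch.h1R measurable_fst (measurable_fst.comp measurable_snd)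
        (c.measurable_dec₁ _)
    have hdisj : Pairwise fun m m' => Disjoint (D m) (D m') := by
      intro m m' hne
      refine Set.disjoint_left.2 fun y hy hy' => hne ?_
      exact Option.some_injective _ (hy.symm.trans hy')
    -- The second message is fixed, so its codeword belongs to the offsets and the second input of
    -- the two-output channel is zero.
    have key := sum_success_mul_log_card_le (fun m i => c.enc₁ m i - μ i) (fun _ _ => 0)
      (fun i => ch.hR1 * μ i + ch.hR2 * c.enc₂ m₂ i) (fun i => ch.h11 * μ i + ch.h12 * c.enc₂ m₂ i)
      ch.hR1 0 ch.h11 0 hP (by simpa using hvar.trans hpow)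
      (by simpa using mul_nonneg hM₁.le (mul_nonneg n.cast_nonneg hP)) (by simp) hD hdisj
    rw [Fintype.card_fin] at key
    refine le_trans ?_ (key.trans_eq ?_)
    · refine mul_le_mul_of_nonneg_right ?_ hlog
      have hM : (M₁ : ℝ) = ∑ _m : Fin M₁, 1 := by simp
      rw [hM, ← Finset.sum_sub_distrib]
      refine Finset.sum_le_sum fun m₁ _ => ?_
      rw [sub_le_iff_le_add]
      refine le_trans ?_ (measureReal_union_le _ _)
      rw [← probReal_univ (μ := noiseLaw n)]
      refine measureReal_mono fun z _ => ?_
      by_cases hz : z ∈ c.errorSet ch m₁ m₂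
      · exact Or.inr hz
      · left
        simp only [errorSet, Set.mem_ofPred_eq, not_not] at hz
        change c.dec₁ (c.addRelay ch.h1R _ _) = some m₁
        rw [c.addRelay_eq_seqY1 ch m₁ m₂ z (fun i => by ring) (fun i => by ring)]
        exact hz.1
    · ring_nf
  have hsum := Finset.sum_le_sum fun m₂ (_ : m₂ ∈ Finset.univ) => hm₂ m₂
  rw [← Finset.sum_mul, Finset.sum_sub_distrib, Finset.sum_comm, c.sum_errorSet ch h₁ h₂] at hsum
  simp only [Finset.sum_const, Finset.card_univ, Fintype.card_fin, nsmul_eq_mul] at hsum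
  have hMM : (0 : ℝ) < M₂ * M₁ := by positivity
  refine le_of_mul_le_mul_left (a := (M₂ * M₁ : ℝ)) ?_ hMM
  linarith

/-- Sum-rate converse at destination 1, which simulates the output of destination 2. -/
theorem sumRate_bound {P : ℝ} (hP : 0 ≤ P) (h₁ : M₁ ≠ 0) (h₂ : M₂ ≠ 0)
    (hgain : ch.h22 ^ 2 ≤ ch.h12 ^ 2)
    (hpow₁ : (M₁ : ℝ)⁻¹ * ∑ m₁, ∑ i, c.enc₁ m₁ i ^ 2 ≤ n * P)
    (hpow₂ : (M₂ : ℝ)⁻¹ * ∑ m₂, ∑ i, c.enc₂ m₂ i ^ 2 ≤ n * P) :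
    (1 - 2 * c.errorProb ch) * Real.log (M₁ * M₂) ≤ Real.log 2 +
      n * (1 / 2 * Real.log ((1 + (ch.h11 ^ 2 + ch.h12 ^ 2) * P) *
        (1 + (ch.hR1 ^ 2 + ch.hR2 ^ 2) * P) -
          (ch.h11 * ch.hR1 + ch.h12 * ch.hR2) ^ 2 * P ^ 2)) := by
  have : NeZero M₁ := ⟨h₁⟩
  have : NeZero M₂ := ⟨h₂⟩
  have hM₁ : (0 : ℝ) < M₁ := by positivity
  have hM₂ : (0 : ℝ) < M₂ := by positivity
  rw [inv_mul_le_iff₀ hM₁] at hpow₁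
  rw [inv_mul_le_iff₀ hM₂] at hpow₂
  obtain ⟨μ₁, hμ₁, hvar₁⟩ := exists_mean c.enc₁
  obtain ⟨μ₂, hμ₂, hvar₂⟩ := exists_mean c.enc₂
  -- The gain inequality from the strong condition is used exactly here: it makes `h22 / h12` a
  -- sine. If `h12 = 0` then `h22 = 0` and `θ = 0` works.
  obtain ⟨θ, hθ⟩ : ∃ θ, Real.sin θ * ch.h12 = ch.h22 := by
    by_cases h0 : ch.h12 = 0
    · have : ch.h22 = 0 := by
        rw [h0] at hgain
        nlinarith [sq_nonneg ch.h22]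
      exact ⟨0, by simp [h0, this]⟩
    · have habs : |ch.h22 / ch.h12| ≤ 1 := by
        rw [abs_div, div_le_one (abs_pos.2 h0)]
        exact sq_le_sq.1 hgain
      exact ⟨Real.arcsin (ch.h22 / ch.h12), by
        rw [Real.sin_arcsin (abs_le.1 habs).1 (abs_le.1 habs).2, div_mul_cancel₀ _ h0]⟩
  -- Simulated output of destination 2, before its relay term. The coordinate `y.2.2`, not shifted
  -- by any signal, supplies independent noise that brings the variance back to `sin² θ + cos² θ =
  -- 1`.
  set sim : Fin M₁ → Noise n → Fin n → ℝ := fun m₁ y i => ch.h21 * c.enc₁ m₁ i +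
    (Real.sin θ * (y.2.1 i - ch.h11 * c.enc₁ m₁ i) + Real.cos θ * y.2.2 i) with hsim
  set D : Fin M₁ × Fin M₂ → Set (Noise n) := fun m =>
    (fun y => c.addRelay ch.h1R y.1 y.2.1) ⁻¹' (c.dec₁ ⁻¹' {some m.1}) ∩
      (fun y => c.addRelay ch.h2R y.1 (sim m.1 y)) ⁻¹' (c.dec₂ ⁻¹' {some m.2}) with hDdef
  have hD : ∀ m, MeasurableSet (D m) := fun m =>
    (c.measurable_addRelay ch.h1R measurable_fst (measurable_fst.comp measurable_snd)
      (c.measurable_dec₁ _)).inter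
    (c.measurable_addRelay ch.h2R measurable_fst (by simp only [hsim]; fun_prop)
      (c.measurable_dec₂ _))
  -- The first messages must be identified first: the simulation depends on `m₁`, so the second
  -- decoder sees the same input only after that.
  have hdisj : Pairwise fun m m' => Disjoint (D m) (D m') := by
    rintro ⟨m₁, m₂⟩ ⟨m₁', m₂'⟩ hne
    refine Set.disjoint_left.2 fun y hy hy' => hne ?_
    obtain rfl : m₁ = m₁' := Option.some_injective _ (hy.1.symm.trans hy'.1)
    obtain rfl : m₂ = m₂' := Option.some_injective _ (hy.2.symm.trans hy'.2)
    rfl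
  have hcard : (Fintype.card (Fin M₁ × Fin M₂) : ℝ) = M₁ * M₂ := by simp
  have key := sum_success_mul_log_card_le (W := Fin M₁ × Fin M₂)
    (fun m i => c.enc₁ m.1 i - μ₁ i) (fun m i => c.enc₂ m.2 i - μ₂ i)
    (fun i => ch.hR1 * μ₁ i + ch.hR2 * μ₂ i) (fun i => ch.h11 * μ₁ i + ch.h12 * μ₂ i)
    ch.hR1 ch.hR2 ch.h11 ch.h12 hP
    (by
      rw [hcard, Fintype.sum_prod_type]
      simp only [Finset.sum_const, Finset.card_univ, Fintype.card_fin, nsmul_eq_mul,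
        ← Finset.mul_sum]
      nlinarith [mul_le_mul_of_nonneg_left (hvar₁.trans hpow₁) hM₂.le])
    (by
      rw [hcard, Fintype.sum_prod_type]
      simp only [Finset.sum_const, Finset.card_univ, Fintype.card_fin, nsmul_eq_mul]
      nlinarith [mul_le_mul_of_nonneg_left (hvar₂.trans hpow₂) hM₁.le])
    (by
      rw [Finset.sum_comm]
      refine Finset.sum_eq_zero fun i _ => ?_
      rw [Fintype.sum_prod_type]
      simp only [← Finset.mul_sum, hμ₂, mul_zero, Finset.sum_const_zero])
    hD hdisj
  rw [hcard] at key
  have hlog : 0 ≤ Real.log (M₁ * M₂ : ℝ) := by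
    have := Real.log_natCast_nonneg (M₁ * M₂)
    rwa [Nat.cast_mul] at this
  have hMM : (0 : ℝ) < M₁ * M₂ := by positivity
  refine le_of_mul_le_mul_left (a := (M₁ * M₂ : ℝ)) (le_trans ?_ key) hMM
  rw [← mul_assoc]
  refine mul_le_mul_of_nonneg_right ?_ hlog
  have hM : (M₁ * M₂ : ℝ) * (1 - 2 * c.errorProb ch) = ∑ m : Fin M₁ × Fin M₂,
      (1 - 2 * (noiseLaw n).real (c.errorSet ch m.1 m.2)) := by
    rw [Finset.sum_sub_distrib, ← Finset.mul_sum,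
      Fintype.sum_prod_type (fun m : Fin M₁ × Fin M₂ => (noiseLaw n).real (c.errorSet ch m.1 m.2)),
      c.sum_errorSet ch h₁ h₂]
    simp
    ring
  rw [hM]
  refine Finset.sum_le_sum ?_
  rintro ⟨m₁, m₂⟩ -
  -- The effective noise: its last component is the noise of the simulated output. The relay noise
  -- is untouched, so the relay sends the same symbols.
  set R : Noise n → Noise n := fun z => ((z.1,
    (fun i => Real.cos θ * z.2.1 i + -Real.sin θ * z.2.2 i),
    (fun i => Real.sin θ * z.2.1 i + Real.cos θ * z.2.2 i)) : Noise n) with hR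
  have hRmp : MeasurePreserving R (noiseLaw n) (noiseLaw n) := by
    have := measurePreserving_noise_rotation n (-θ)
    simpa only [Real.sin_neg, Real.cos_neg, neg_neg] using this
  set E₂ : Set (Noise n) := {z | c.dec₂ (c.seqY2 ch m₁ m₂ z) ≠ some m₂} with hE₂
  have hE₂m : MeasurableSet E₂ := (c.measurable_seqY2 ch m₁ m₂ (c.measurable_dec₂ (some m₂))).compl
  have hE₂le : (noiseLaw n).real (R ⁻¹' E₂) ≤ (noiseLaw n).real (c.errorSet ch m₁ m₂) := by
    rw [measureReal_def, hRmp.measure_preimage hE₂m.nullMeasurableSet]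
    exact measureReal_mono fun z hz h => hz h.2
  -- Union bound over an error under the actual noise and a failure of the second decoder under the
  -- rotated noise. Each has probability at most that of `errorSet`, hence the factor `2`.
  rw [sub_le_iff_le_add, two_mul]
  refine le_trans ?_ (add_le_add_right (add_le_add_left hE₂le _) _)
  refine le_trans ?_ (add_le_add_right (measureReal_union_le _ _) _)
  refine le_trans ?_ (measureReal_union_le _ _)
  rw [← probReal_univ (μ := noiseLaw n)]
  refine measureReal_mono fun z _ => ?_
  by_cases hz : z ∈ c.errorSet ch m₁ m₂
  · exact Or.inr (Or.inr hz)
  by_cases hz2 : z ∈ R ⁻¹' E₂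
  · exact Or.inr (Or.inl hz2)
  refine Or.inl ⟨?_, ?_⟩
  · simp only [errorSet, Set.mem_ofPred_eq, not_not] at hz
    change c.dec₁ (c.addRelay ch.h1R _ _) = some m₁
    rw [c.addRelay_eq_seqY1 ch m₁ m₂ z (fun i => by ring) (fun i => by ring)]
    exact hz.1
  · simp only [hE₂, Set.mem_preimage, Set.mem_ofPred_eq, ne_eq, not_not] at hz2
    change c.dec₂ _ = some m₂
    rw [← hz2]
    congr 1
    ext i
    simp only [addRelay, relayOut, shiftMap, hsim, seqY2, seqXR, hR, out2]
    have : ∀ j, ch.hR1 * μ₁ j + ch.hR2 * μ₂ j + ch.hR1 * (c.enc₁ m₁ j - μ₁ j) +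
        ch.hR2 * (c.enc₂ m₂ j - μ₂ j) + z.1 j = c.seqYR ch m₁ m₂ (R z) j := by
      intro j
      simp only [seqYR, outR, hR]
      ring
    simp only [this]
    linear_combination c.enc₂ m₂ i * hθ

end Code

end GaussianIRC

/-! ### Exchange of the users and passage to the limit -/

namespace GaussianIRC

/-- The channel with the roles of the two source-destination pairs exchanged. -/
def swap (ch : GaussianIRC) : GaussianIRC where
  h11 := ch.h22
  h12 := ch.h21
  h21 := ch.h12
  h22 := ch.h11
  hR1 := ch.hR2
  hR2 := ch.hR1
  h1R := ch.h2R
  h2R := ch.h1R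

/-- The code with the roles of the two source-destination pairs exchanged. -/
def Code.swap {M₁ M₂ n : ℕ} (c : Code M₁ M₂ n) : Code M₂ M₁ n where
  enc₁ := c.enc₂
  enc₂ := c.enc₁
  relay := c.relay
  dec₁ := c.dec₂
  dec₂ := c.dec₁
  measurable_relay := c.measurable_relay
  measurable_dec₁ := c.measurable_dec₂
  measurable_dec₂ := c.measurable_dec₁

lemma Code.errorProb_swap (ch : GaussianIRC) {M₁ M₂ n : ℕ} (c : Code M₁ M₂ n) :
    c.swap.errorProb ch.swap = c.errorProb ch := by
  rw [errorProb, errorProb, Finset.sum_comm, mul_comm (M₂ : ℝ)]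
  congr 1
  refine Finset.sum_congr rfl fun m₁ _ => Finset.sum_congr rfl fun m₂ _ => ?_
  have hR : ∀ z : Noise n, c.swap.seqYR ch.swap m₂ m₁ z = c.seqYR ch m₁ m₂ z := by
    intro z
    ext i
    simp only [seqYR, outR, GaussianIRC.swap, Code.swap]
    ring
  have h1 : ∀ z : Noise n, c.swap.seqY1 ch.swap m₂ m₁ (z.1, z.2.2, z.2.1) = c.seqY2 ch m₁ m₂ z := by
    intro z
    ext i
    simp only [seqY1, seqY2, out1, out2, seqXR, hR]
    simp only [seqYR, GaussianIRC.swap, Code.swap]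
    ring
  have h2 : ∀ z : Noise n, c.swap.seqY2 ch.swap m₂ m₁ (z.1, z.2.2, z.2.1) = c.seqY1 ch m₁ m₂ z := by
    intro z
    ext i
    simp only [seqY1, seqY2, out1, out2, seqXR, hR]
    simp only [seqYR, GaussianIRC.swap, Code.swap]
    ring
  have he : MeasurableEmbedding (fun z : Noise n => ((z.1, z.2.2, z.2.1) : Noise n)) :=
    ((MeasurableEquiv.refl _).prodCongr MeasurableEquiv.prodComm).measurableEmbedding
  -- Exchanging the noises is a measurable embedding, so the measure of the preimage is known
  -- without proving the error event measurable.
  rw [measureReal_def, measureReal_def,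
    ← (measurePreserving_noise_swap n).measure_preimage_emb he]
  congr 2
  ext z
  simp only [Set.mem_preimage, Set.mem_ofPred_eq, h1, h2]
  rw [and_comm]
  rfl

lemma le_of_forall_mul_log_le {ε L : ℕ → ℝ} {K R B : ℝ} (hε : Tendsto ε atTop (𝓝 0))
    (hL : ∀ n : ℕ, n * R * Real.log 2 ≤ L n)
    (h : ∀ n : ℕ, (1 - K * ε n) * L n ≤ Real.log 2 + n * (1 / 2 * Real.log B)) :
    R ≤ 1 / 2 * Real.logb 2 B := by
  have hlog2 : 0 < Real.log 2 := Real.log_pos (by norm_num)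
  have hlim : Tendsto (fun n => 1 - K * ε n) atTop (𝓝 1) := by
    simpa using (hε.const_mul K).const_sub 1
  have hev : ∀ᶠ n : ℕ in atTop, (1 - K * ε n) * (R * Real.log 2) ≤
      Real.log 2 / n + 1 / 2 * Real.log B := by
    -- Replacing `L n` by its lower bound `n * R * log 2` requires a nonnegative factor `1 - K * ε
    -- n`, which holds for large `n`.
    filter_upwards [hlim.eventually (lt_mem_nhds zero_lt_one), eventually_gt_atTop 0] with n hn hn0
    have hn0' : (0 : ℝ) < n := by exact_mod_cast hn0
    have := (mul_le_mul_of_nonneg_left (hL n) hn.le).trans (h n)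
    refine le_of_mul_le_mul_left (a := (n : ℝ)) ?_ hn0'
    rw [mul_add, mul_div_cancel₀ _ hn0'.ne']
    linarith
  have hle := le_of_tendsto_of_tendsto (hlim.mul_const (R * Real.log 2))
    ((tendsto_const_div_atTop_nhds_zero_nat (Real.log 2)).add_const (1 / 2 * Real.log B)) hev
  rw [Real.logb, ← mul_div_assoc, le_div_iff₀ hlog2]
  linarith

lemma numMessages_ne_zero (n : ℕ) (R : ℝ) : numMessages n R ≠ 0 :=
  (Nat.ceil_pos.2 (by positivity)).ne'

lemma le_log_numMessages (n : ℕ) (R : ℝ) :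
    n * R * Real.log 2 ≤ Real.log (numMessages n R) := by
  rw [← Real.log_rpow (by norm_num)]
  exact Real.log_le_log (by positivity) (Nat.le_ceil _)

end GaussianIRC

theorem theorem3 (ch : GaussianIRC) (P P_R : ℝ) (hP : 0 ≤ P) (hPR : 0 ≤ P_R)
    (hstrong : ch.IsStrong) :
    ch.capacityRegion P P_R ⊆
      {R : ℝ × ℝ |
        R.1 ≤ 1 / 2 * Real.logb 2 (1 + (ch.h11 ^ 2 + ch.hR1 ^ 2) * P) ∧
        R.2 ≤ 1 / 2 * Real.logb 2 (1 + (ch.h22 ^ 2 + ch.hR2 ^ 2) * P) ∧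
        R.1 + R.2 ≤ 1 / 2 * Real.logb 2
          (1 + (ch.h11 ^ 2 + ch.h12 ^ 2 + ch.hR1 ^ 2 + ch.hR2 ^ 2) * P +
            ((ch.h11 ^ 2 + ch.h12 ^ 2) * (ch.hR1 ^ 2 + ch.hR2 ^ 2) -
              (ch.h11 * ch.hR1 + ch.h12 * ch.hR2) ^ 2) * P ^ 2) ∧
        R.1 + R.2 ≤ 1 / 2 * Real.logb 2
          (1 + (ch.h21 ^ 2 + ch.h22 ^ 2 + ch.hR1 ^ 2 + ch.hR2 ^ 2) * P +
            ((ch.h21 ^ 2 + ch.h22 ^ 2) * (ch.hR1 ^ 2 + ch.hR2 ^ 2) -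
              (ch.h21 * ch.hR1 + ch.h22 * ch.hR2) ^ 2) * P ^ 2)} := by
  obtain ⟨hg₁, hg₂⟩ := hstrong.sq_gain_le
  refine closure_minimal ?_ ?_
  · rintro ⟨R₁, R₂⟩ ⟨-, -, c, hpow, herr⟩
    have hn := GaussianIRC.numMessages_ne_zero
    have hlogmul : ∀ n : ℕ, n * (R₁ + R₂) * Real.log 2 ≤
        Real.log (GaussianIRC.numMessages n R₁ * GaussianIRC.numMessages n R₂) := by
      intro n
      rw [Real.log_mul (Nat.cast_ne_zero.2 (hn n R₁)) (Nat.cast_ne_zero.2 (hn n R₂))]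
      linarith [GaussianIRC.le_log_numMessages n R₁, GaussianIRC.le_log_numMessages n R₂]
    -- The second and fourth bounds are the first and third for the exchanged channel; its gain
    -- condition `h22 ^ 2 ≤ h12 ^ 2` is `hg₁`.
    have herr' : Tendsto (fun n => (c n).swap.errorProb ch.swap) atTop (𝓝 0) := by
      simpa only [GaussianIRC.Code.errorProb_swap] using herr
    refine ⟨?_, ?_, ?_, ?_⟩
    · refine GaussianIRC.le_of_forall_mul_log_le (K := 1) herr (fun n => GaussianIRC.le_log_numMessages n R₁) fun n => ?_
      rw [one_mul]
      exact (c n).rate₁_bound ch hP (hn n _) (hn n _) (hpow n).1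
    · refine GaussianIRC.le_of_forall_mul_log_le (K := 1) herr' (fun n => GaussianIRC.le_log_numMessages n R₂) fun n => ?_
      rw [one_mul]
      exact (c n).swap.rate₁_bound ch.swap hP (hn n _) (hn n _) (hpow n).2.1
    · refine GaussianIRC.le_of_forall_mul_log_le (K := 2) herr hlogmul fun n => ?_
      refine ((c n).sumRate_bound ch hP (hn n _) (hn n _) hg₂ (hpow n).1 (hpow n).2.1).trans_eq ?_
      ring_nf
    · refine GaussianIRC.le_of_forall_mul_log_le (K := 2) herr' hlogmul fun n => ?_
      rw [mul_comm (GaussianIRC.numMessages n R₁ : ℝ)]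
      refine ((c n).swap.sumRate_bound ch.swap hP (hn n _) (hn n _) hg₁
        (hpow n).2.1 (hpow n).1).trans_eq ?_
      simp only [GaussianIRC.swap]
      ring_nf
  · simp only [Set.ofPred_and]
    refine (isClosed_le (by fun_prop) (by fun_prop)).inter
      ((isClosed_le (by fun_prop) (by fun_prop)).inter
        ((isClosed_le (by fun_prop) (by fun_prop)).inter (isClosed_le (by fun_prop) (by fun_prop))))
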